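/- **Proposition (Interaction Energy).** Let $N\ge 1$ and let $B_F\subset\mathbb{Z}^3$ be a set of $N$ lattice points of smallest length, i.e. $|h|\le|p|$ for all $h\in B_F$, $p\in B_F^c:=\mathbb{Z}^3\setminus B_F$ (for instance a ball around the origin containing exactly $N$ lattice points). On the fermionic Fock space over $L^2(\mathbb{T}^3)$ with vacuum $\Omega$, number operator $\mathcal N$ and creation and annihilation operators $a^*_p,a_p$ of the plane waves $(2\pi)^{-3/2}e^{ip\cdot x}$, $p \in \mathbb{Z}^3$, put $$\tilde b^*_k=\sum_{p\in B_F^c,\ h\in B_F}\delta_{p-h,k}\,a^*_pa^*_h,\qquad n_k=\|\tilde b^*_k\Omega\|,\qquad b^*_k=n_k^{-1}\tilde b^*_k\quad(k\neq 0),$$ where $\tilde b_k$, $b_k$ denote the adjoints of $\tilde b^*_k$, $b^*_k$. Let $\hat V:\mathbb{Z}^3\to\mathbb{R}$ with $\sum_k|\hat V(k)|<\infty$ and $$Q_N^{(0)}=\frac1{2N}\sum_{k\in\mathbb{Z}^3\setminus\{0\}}\hat V(k)\big(2\tilde b^*_k\tilde b_k+\tilde b^*_k\tilde b^*_{-k}+\tilde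 b_{-k}\tilde b_k\big).$$ Let $\Xi:\mathbb{Z}^3\to\mathbb{C}$ satisfy $\Xi(-k)=\Xi(k)$ and $\sum_k|\Xi(k)|<\infty$, and let $T(t)=e^{tB}$, $T=T(1)$, with $$B=\frac12\sum_{k\in\mathbb{Z}^3\setminus\{0\}}\Xi(k)b^*_kb^*_{-k}-\mathrm{h.c.}$$ Then the following series converges absolutely, and $$\langle T\Omega,Q_N^{(0)}T\Omega\rangle=\frac1N\,\mathrm{Re}\sum_{k\in\mathbb{Z}^3\setminus\{0\}}\hat V(k)n_k^2\Big(\sinh(|\Xi(k)|)^2+\frac{\overline{\Xi(k)}}{|\Xi(k)|}\sinh(|\Xi(k)|)\cosh(|\Xi(k)|)\Big)+\varepsilon_1,$$ where the second summand in the parentheses is read as $0$ if $\Xi(k)=0$, and the error $\varepsilon_1\in\mathbb{C}$ satisfies, as an inequality in $[0,\infty]$, $$\begin{aligned}|\varepsilon_1|\le\frac1N\sum_{k\in\mathbb{Z}^3\setminus\{0\}}|\hat V(k)|\,n_k^2\Bigg[&4\sup_{t\in[0,1]}\langle T(t)\Omega,(\mathcal N+2)^3T(t)\Omega\rangle\,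 e^{2|\Xi(k)|}\Big(\sum_{m\in\mathbb{Z}^3\setminus\{0\}}\frac{|\Xi(m)|}{n_mn_k}\Big)^2\\&+\big(4\sinh(|\Xi(k)|)+2\cosh(|\Xi(k)|)\big)\sup_{t\in[0,1]}\big\|(\mathcal N+2)^{3/2}T(t)\Omega\big\|\,e^{|\Xi(k)|}\sum_{m\in\mathbb{Z}^3\setminus\{0\}}\frac{|\Xi(m)|}{n_mn_k}\Bigg].\end{aligned}$$ -/

import Mathlib

open scoped ENNReal

noncomputable section

namespace FermiGas

/-- Momenta: the lattice `ℤ³`, labelling the plane waves `f_k(x) = (2π)^{-3/2} e^{ik·x}` of the torus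
`𝕋³ = [0,2π]³`, which form an orthonormal basis of `L²(𝕋³)`. -/
abbrev Momentum : Type := Fin 3 → ℤ

/-- The squared Euclidean length `|k|²`. -/
def normSq (k : Momentum) : ℤ := ∑ i, k i ^ 2

/-- `BF` consists of lattice points of smallest length: no point outside is strictly shorter than a
point inside. Balls around the origin are of this kind. -/
def IsFermiBall (BF : Finset Momentum) : Prop :=
  ∀ h ∈ BF, ∀ p ∉ BF, normSq h ≤ normSq p

/-- The lexicographic order on momenta; it only fixes the signs of the basis vectors below. -/
def lexLT (q p : Momentum) : Prop :=
  q 0 < p 0 ∨ (q 0 = p 0 ∧ (q 1 < p 1 ∨ (q 1 = p 1 ∧ q 2 < p 2)))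

instance : DecidableRel lexLT := fun q p => by
  unfold lexLT
  infer_instance

/-- The fermionic Fock space over `L²(𝕋³)` in the occupation number representation of the plane wave
basis: the Hilbert space with orthonormal basis `e_S`, `S` a finite set of momenta. For
`S = {p₁ < ⋯ < pₙ}` (lexicographic order), `e_S` is the normalized Slater determinant
`a*_{p₁} ⋯ a*_{pₙ} Ω` of the plane waves `f_{p₁}, …, f_{pₙ}`. -/
abbrev Fock : Type := lp (fun _ : Finset Momentum => ℂ) 2

/-- The Fock vacuum `Ω = e_∅`. -/
def vacuum : Fock := lp.single 2 ∅ 1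

/-- The fermionic sign `(-1)^{#{q ∈ S : q < p}}`. -/
def fermiSign (p : Momentum) (S : Finset Momentum) : ℂ :=
  (-1) ^ (S.filter fun q => lexLT q p).card

theorem norm_fermiSign (p : Momentum) (S : Finset Momentum) : ‖fermiSign p S‖ = 1 := by
  simp [fermiSign]

/-- The components of `a_p ψ`; equivalently, `a_p e_{S ∪ {p}} = ± e_S` for `p ∉ S` and
`a_p e_S = 0` for `p ∉ S`, with the sign `(-1)^{#{q ∈ S : q < p}}`. -/
def annihilationFun (p : Momentum) (ψ : Finset Momentum → ℂ) (S : Finset Momentum) : ℂ :=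
  if p ∈ S then 0 else fermiSign p S * ψ (insert p S)

theorem sum_annihilationFun_le (p : Momentum) (ψ : Fock) (s : Finset (Finset Momentum)) :
    ∑ S ∈ s, ‖annihilationFun p ψ S‖ ^ (2 : ℝ≥0∞).toReal ≤ ‖ψ‖ ^ (2 : ℝ≥0∞).toReal := by
  classical
  have h2 : (0 : ℝ) < (2 : ℝ≥0∞).toReal := by norm_num
  have h1 : ∑ S ∈ s, ‖annihilationFun p ψ S‖ ^ (2 : ℝ≥0∞).toReal
      = ∑ S ∈ s.filter (fun S => p ∉ S), ‖ψ (insert p S)‖ ^ (2 : ℝ≥0∞).toReal := by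
    rw [Finset.sum_filter]
    refine Finset.sum_congr rfl fun S _ => ?_
    by_cases h : p ∈ S
    · simp [annihilationFun, h]
    · simp [annihilationFun, h, norm_fermiSign]
  have hinj : Set.InjOn (fun S : Finset Momentum => insert p S)
      (s.filter (fun S => p ∉ S) : Finset (Finset Momentum)) := by
    intro S hS S' hS' h
    have hS := (Finset.mem_filter.1 hS).2
    have hS' := (Finset.mem_filter.1 hS').2
    have := congrArg (fun A : Finset Momentum => A.erase p) h
    simpa [Finset.erase_insert hS, Finset.erase_insert hS'] using this
  rw [h1, ← Finset.sum_image (f := fun S => ‖ψ S‖ ^ (2 : ℝ≥0∞).toReal) hinj]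
  exact lp.sum_rpow_le_norm_rpow h2 ψ _

/-- The annihilation operator `a_p = a(f_p)`, a bounded operator on Fock space. -/
def annihilation (p : Momentum) : Fock →L[ℂ] Fock :=
  LinearMap.mkContinuous
    { toFun := fun ψ => ⟨annihilationFun p ψ, memℓp_gen' (sum_annihilationFun_le p ψ)⟩
      map_add' := by
        intro ψ φ
        ext S
        change annihilationFun p (ψ + φ : Fock) S = annihilationFun p ψ S + annihilationFun p φ S
        by_cases h : p ∈ S <;> simp [annihilationFun, h, mul_add]
      map_smul' := by
        intro c ψ
        ext S
        change annihilationFun p (c • ψ : Fock) S = c * annihilationFun p ψ S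
        by_cases h : p ∈ S
        · simp [annihilationFun, h]
        · simp [annihilationFun, h]
          ring }
    1 (by
      intro ψ
      rw [one_mul]
      exact lp.norm_le_of_forall_sum_le (by norm_num) (norm_nonneg _)
        (sum_annihilationFun_le p ψ))

/-- The creation operator `a*_p`, the adjoint of `a_p`. -/
def creation (p : Momentum) : Fock →L[ℂ] Fock :=
  ContinuousLinearMap.adjoint (annihilation p)

/-- The expectation value `⟨ψ, f(𝒩) ψ⟩ ∈ [0,∞]` for `f ≥ 0`, where `𝒩 = ∑_p a*_p a_p` is the number
operator, which acts by `𝒩 e_S = |S| e_S`. -/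
def numberExpect (f : ℕ → ℝ) (ψ : Fock) : ℝ≥0∞ :=
  ∑' S : Finset Momentum, ENNReal.ofReal (f S.card) * ‖ψ S‖ₑ ^ 2

/-- The norm `‖f(𝒩) ψ‖ ∈ [0,∞]` (infinite if `ψ` is not in the domain of `f(𝒩)`). -/
def numberNorm (f : ℕ → ℝ) (ψ : Fock) : ℝ≥0∞ :=
  (∑' S : Finset Momentum, ‖(f S.card : ℂ) * ψ S‖ₑ ^ 2) ^ (1 / 2 : ℝ)

/-- The collective particle-hole pair creation operator
`b̃*_k = ∑_{p ∉ BF, h ∈ BF} δ_{p-h,k} a*_p a*_h`. -/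
def pairCreationTilde (BF : Finset Momentum) (k : Momentum) : Fock →L[ℂ] Fock :=
  ∑ h ∈ BF.filter (fun h => h + k ∉ BF), creation (h + k) * creation h

/-- `b̃_k`, the adjoint of `b̃*_k`. -/
def pairAnnihilationTilde (BF : Finset Momentum) (k : Momentum) : Fock →L[ℂ] Fock :=
  ContinuousLinearMap.adjoint (pairCreationTilde BF k)

/-- The normalization constant `n_k = ‖b̃*_k Ω‖`. -/
def pairNorm (BF : Finset Momentum) (k : Momentum) : ℝ :=
  ‖pairCreationTilde BF k vacuum‖

/-- The normalized pair creation operator `b*_k = n_k⁻¹ b̃*_k`. -/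
def pairCreation (BF : Finset Momentum) (k : Momentum) : Fock →L[ℂ] Fock :=
  ((pairNorm BF k : ℂ)⁻¹) • pairCreationTilde BF k

/-- The operator `½ ∑_{k ≠ 0} Ξ(k) b*_k b*_{-k}`, a series in operator norm. -/
def bogoliubovCreationPart (BF : Finset Momentum) (Ξ : Momentum → ℂ) : Fock →L[ℂ] Fock :=
  (1 / 2 : ℂ) • ∑' k : {k : Momentum // k ≠ 0},
    Ξ k • (pairCreation BF k * pairCreation BF (-(k : Momentum)))

/-- The generator `B = ½ ∑_{k ≠ 0} Ξ(k) b*_k b*_{-k} - h.c.` -/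
def bogoliubovGenerator (BF : Finset Momentum) (Ξ : Momentum → ℂ) : Fock →L[ℂ] Fock :=
  bogoliubovCreationPart BF Ξ - ContinuousLinearMap.adjoint (bogoliubovCreationPart BF Ξ)

/-- The almost-bosonic Bogoliubov transformation `T(t) = exp(t B)`. -/
def bogoliubov (BF : Finset Momentum) (Ξ : Momentum → ℂ) (t : ℝ) : Fock →L[ℂ] Fock :=
  NormedSpace.exp ((t : ℂ) • bogoliubovGenerator BF Ξ)

/-- The `k`-th term `V̂(k) (2 b̃*_k b̃_k + b̃*_k b̃*_{-k} + b̃_{-k} b̃_k)` of the interaction. -/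
def interactionTerm (BF : Finset Momentum) (V : Momentum → ℝ) (k : Momentum) : Fock →L[ℂ] Fock :=
  (V k : ℂ) • ((2 : ℂ) • (pairCreationTilde BF k * pairAnnihilationTilde BF k)
    + pairCreationTilde BF k * pairCreationTilde BF (-k)
    + pairAnnihilationTilde BF (-k) * pairAnnihilationTilde BF k)

/-- The interaction operator
`Q_N^{(0)} = (2N)⁻¹ ∑_{k ≠ 0} V̂(k) (2 b̃*_k b̃_k + b̃*_k b̃*_{-k} + b̃_{-k} b̃_k)`, with `N` the number
of points of the Fermi ball, a series in operator norm. -/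
def interaction (BF : Finset Momentum) (V : Momentum → ℝ) : Fock →L[ℂ] Fock :=
  (1 / (2 * (BF.card : ℂ))) • ∑' k : {k : Momentum // k ≠ 0}, interactionTerm BF V k

/-- The trial state `TΩ` along the flow: `T(t) Ω`. -/
def trialState (BF : Finset Momentum) (Ξ : Momentum → ℂ) (t : ℝ) : Fock :=
  bogoliubov BF Ξ t vacuum

/-- The leading term at momentum `k`,
`V̂(k) n_k² (sinh²|Ξ(k)| + (conj Ξ(k) / |Ξ(k)|) sinh|Ξ(k)| cosh|Ξ(k)|)`; the second summand
vanishes where `Ξ(k) = 0`. -/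
def leadingTerm (BF : Finset Momentum) (V : Momentum → ℝ) (Ξ : Momentum → ℂ) (k : Momentum) : ℂ :=
  ((V k * pairNorm BF k ^ 2 : ℝ) : ℂ) *
    (((Real.sinh ‖Ξ k‖ ^ 2 : ℝ) : ℂ)
      + starRingEnd ℂ (Ξ k) / ((‖Ξ k‖ : ℝ) : ℂ) *
        ((Real.sinh ‖Ξ k‖ * Real.cosh ‖Ξ k‖ : ℝ) : ℂ))

/-- `∑_{m ≠ 0} |Ξ(m)| / (n_m n_k)`. -/
def kernelSum (BF : Finset Momentum) (Ξ : Momentum → ℂ) (k : Momentum) : ℝ≥0∞ :=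
  ∑' m : {m : Momentum // m ≠ 0}, ENNReal.ofReal (‖Ξ m‖ / (pairNorm BF m * pairNorm BF k))

/-- `sup_{t ∈ [0,1]} ⟨T(t)Ω, (𝒩+2)³ T(t)Ω⟩`. -/
def supNumberExpect (BF : Finset Momentum) (Ξ : Momentum → ℂ) : ℝ≥0∞ :=
  ⨆ t ∈ Set.Icc (0 : ℝ) 1, numberExpect (fun j => ((j : ℝ) + 2) ^ 3) (trialState BF Ξ t)

/-- `sup_{t ∈ [0,1]} ‖(𝒩+2)^{3/2} T(t)Ω‖`. -/
def supNumberNorm (BF : Finset Momentum) (Ξ : Momentum → ℂ) : ℝ≥0∞ :=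
  ⨆ t ∈ Set.Icc (0 : ℝ) 1,
    numberNorm (fun j => ((j : ℝ) + 2) ^ (3 / 2 : ℝ)) (trialState BF Ξ t)

/-! The two operator series converge absolutely, and `n_k > 0` for `k ≠ 0`. -/

theorem norm_annihilation_le (p : Momentum) : ‖annihilation p‖ ≤ 1 :=
  LinearMap.mkContinuous_norm_le _ zero_le_one _

theorem norm_creation_le (p : Momentum) : ‖creation p‖ ≤ 1 := by
  rw [creation, LinearIsometryEquiv.norm_map]
  exact norm_annihilation_le p

theorem annihilation_single (p : Momentum) (S : Finset Momentum) (hp : p ∈ S) :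
    annihilation p (lp.single 2 S 1) = fermiSign p (S.erase p) • lp.single 2 (S.erase p) 1 := by
  ext A
  change annihilationFun p (lp.single 2 S (1 : ℂ) : Fock) A = fermiSign p (S.erase p) *
    (lp.single 2 (S.erase p) (1 : ℂ) : Fock) A
  by_cases h : p ∈ A
  · have : A ≠ S.erase p := by rintro rfl; simp at h
    simp [annihilationFun, h, lp.single_apply, this]
  · by_cases hA : A = S.erase p
    · subst hA
      simp [annihilationFun, lp.single_apply, Finset.insert_erase hp]
    · have : insert p A ≠ S := by
        rintro rfl
        exact hA (Finset.erase_insert h).symm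
      simp [annihilationFun, h, lp.single_apply, this, hA]

theorem annihilation_single_of_notMem (p : Momentum) (S : Finset Momentum) (hp : p ∉ S) :
    annihilation p (lp.single 2 S 1) = 0 := by
  ext A
  change annihilationFun p (lp.single 2 S (1 : ℂ) : Fock) A = 0
  have : insert p A ≠ S := by rintro rfl; simp at hp
  simp [annihilationFun, lp.single_apply, this]

theorem creation_apply (p : Momentum) (ψ : Fock) (S : Finset Momentum) :
    creation p ψ S = if p ∈ S then fermiSign p (S.erase p) * ψ (S.erase p) else 0 := by
  have h : creation p ψ S = inner ℂ (lp.single 2 S (1 : ℂ) : Fock) (creation p ψ) := by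
    rw [lp.inner_single_left]
    simp
  rw [h, creation, ContinuousLinearMap.adjoint_inner_right]
  split_ifs with hp
  · rw [annihilation_single p S hp, inner_smul_left, lp.inner_single_left]
    simp [fermiSign]
  · rw [annihilation_single_of_notMem p S hp, inner_zero_left]

theorem norm_pairCreationTilde_le (BF : Finset Momentum) (k : Momentum) :
    ‖pairCreationTilde BF k‖ ≤ BF.card := by
  refine (norm_sum_le _ _).trans ?_
  refine (Finset.sum_le_card_nsmul _ _ 1 fun h _ => ?_).trans ?_
  · exact (norm_mul_le _ _).trans
      (mul_le_one₀ (norm_creation_le _) (norm_nonneg _) (norm_creation_le _))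
  · rw [nsmul_eq_mul, mul_one]
    exact_mod_cast Finset.card_filter_le _ _

theorem norm_pairAnnihilationTilde_le (BF : Finset Momentum) (k : Momentum) :
    ‖pairAnnihilationTilde BF k‖ ≤ BF.card := by
  rw [pairAnnihilationTilde, LinearIsometryEquiv.norm_map]
  exact norm_pairCreationTilde_le BF k

theorem pairCreationTilde_vacuum_apply (BF : Finset Momentum) (k h : Momentum) (hh : h ∈ BF)
    (hk : h + k ∉ BF) : ‖pairCreationTilde BF k vacuum {h + k, h}‖ = 1 := by
  have hne : h ≠ h + k := fun e => hk (e ▸ hh)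
  have key : pairCreationTilde BF k vacuum {h + k, h}
      = (creation (h + k) (creation h vacuum) : Fock) {h + k, h} := by
    rw [pairCreationTilde, sum_apply, lp.coeFn_sum, Finset.sum_apply]
    refine Finset.sum_eq_single_of_mem h (by simp [hh, hk]) fun h' hh' hne' => ?_
    rw [Finset.mem_filter] at hh'
    change (creation (h' + k) (creation h' vacuum) : Fock) {h + k, h} = 0
    have h1 : h' + k ≠ h + k := fun e => hne' (add_right_cancel e)
    have h2 : h' + k ≠ h := fun e => hh'.2 (e ▸ hh)
    rw [creation_apply, if_neg (by simp [h1, h2])]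
  have he : ({h + k, h} : Finset Momentum).erase (h + k) = {h} := by
    rw [Finset.erase_insert (by simpa using hne.symm)]
  rw [key, creation_apply, if_pos (by simp), he, creation_apply, if_pos (by simp)]
  simp [norm_fermiSign, vacuum]

theorem one_le_pairNorm (BF : Finset Momentum) (k h : Momentum) (hh : h ∈ BF) (hk : h + k ∉ BF) :
    1 ≤ pairNorm BF k := by
  rw [← pairCreationTilde_vacuum_apply BF k h hh hk]
  exact lp.norm_apply_le_norm two_ne_zero _ _

theorem pairNorm_pos (BF : Finset Momentum) (hBF : BF.Nonempty) (k : Momentum) (hk : k ≠ 0) :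
    0 < pairNorm BF k := by
  by_contra hcon
  have hstab : ∀ h ∈ BF, h + k ∈ BF := fun h hh => by
    by_contra hhk
    exact hcon (one_pos.trans_le (one_le_pairNorm BF k h hh hhk))
  obtain ⟨h₀, hh₀⟩ := hBF
  have hmem : ∀ n : ℕ, h₀ + n • k ∈ BF := by
    intro n
    induction n with
    | zero => simpa using hh₀
    | succ n ih =>
      have := hstab _ ih
      rwa [add_assoc, ← succ_nsmul] at this
  refine Set.infinite_of_injective_forall_mem (f := fun n : ℕ => h₀ + n • k) ?_ hmem
    BF.finite_toSet
  intro m n hmn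
  obtain ⟨i, hi⟩ := Function.ne_iff.1 hk
  have := congrFun (add_left_cancel hmn) i
  simpa [show k i ≠ 0 from hi] using this

theorem norm_pairCreation_le (BF : Finset Momentum) (k : Momentum) :
    ‖pairCreation BF k‖ ≤ BF.card := by
  by_cases hex : ∃ h ∈ BF, h + k ∉ BF
  · obtain ⟨h, hh, hk⟩ := hex
    have h1 := one_le_pairNorm BF k h hh hk
    rw [pairCreation, norm_smul]
    refine (mul_le_of_le_one_left (norm_nonneg _) ?_).trans (norm_pairCreationTilde_le BF k)
    rw [norm_inv, Complex.norm_real, Real.norm_of_nonneg (by linarith)]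
    exact inv_le_one_of_one_le₀ h1
  · have : pairCreationTilde BF k = 0 := by
      rw [pairCreationTilde, Finset.filter_eq_empty_iff.2, Finset.sum_empty]
      intro h hh hk
      exact hex ⟨h, hh, hk⟩
    simp [pairCreation, this]

theorem summable_bogoliubov (BF : Finset Momentum) (Ξ : Momentum → ℂ)
    (hΞ : Summable fun k => ‖Ξ k‖) :
    Summable fun k : {k : Momentum // k ≠ 0} =>
      Ξ k • (pairCreation BF k * pairCreation BF (-(k : Momentum))) := by
  refine Summable.of_norm_bounded (g := fun k : {k : Momentum // k ≠ 0} =>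
    ‖Ξ k‖ * ((BF.card : ℝ) * BF.card)) ?_ fun k => ?_
  · exact (hΞ.comp_injective Subtype.val_injective).mul_right _
  · rw [norm_smul]
    refine mul_le_mul_of_nonneg_left ((norm_mul_le _ _).trans ?_) (norm_nonneg _)
    exact mul_le_mul (norm_pairCreation_le _ _) (norm_pairCreation_le _ _) (norm_nonneg _)
      (Nat.cast_nonneg _)

theorem summable_interaction (BF : Finset Momentum) (V : Momentum → ℝ)
    (hV : Summable fun k => |V k|) :
    Summable fun k : {k : Momentum // k ≠ 0} => interactionTerm BF V k := by
  refine Summable.of_norm_bounded (g := fun k : {k : Momentum // k ≠ 0} =>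
    |V k| * (4 * ((BF.card : ℝ) * BF.card))) ?_ fun k => ?_
  · exact (hV.comp_injective Subtype.val_injective).mul_right _
  · have hprod : ∀ A A' : Fock →L[ℂ] Fock, ‖A‖ ≤ BF.card → ‖A'‖ ≤ BF.card →
        ‖A * A'‖ ≤ (BF.card : ℝ) * BF.card := fun A A' h h' =>
      (norm_mul_le _ _).trans (mul_le_mul h h' (norm_nonneg _) (Nat.cast_nonneg _))
    have h1 := hprod _ _ (norm_pairCreationTilde_le BF k) (norm_pairAnnihilationTilde_le BF k)
    have h2 := hprod _ _ (norm_pairCreationTilde_le BF k) (norm_pairCreationTilde_le BF (-k))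
    have h3 := hprod _ _ (norm_pairAnnihilationTilde_le BF (-k))
      (norm_pairAnnihilationTilde_le BF k)
    rw [interactionTerm, norm_smul, Complex.norm_real, Real.norm_eq_abs]
    refine mul_le_mul_of_nonneg_left ((norm_add₃_le).trans ?_) (abs_nonneg _)
    rw [norm_smul, Complex.norm_ofNat]
    linarith

end FermiGas

end

/-!
The pair operators `b*_k` are almost bosonic. By the anticommutation relations,
`[b_k, b*_l] = δ_{kl} + E(k,l)`, where `E(k,l)` is `-(n_k n_l)⁻¹` times a sum of hoppings
`a*_q a_{q'}` (`commutator_pairTilde`). Holes hop inside and particles outside the Fermi ball, so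
this sum is the second quantization of a partial isometry and `‖E(k,l)‖ ≤ n / (n_k n_l)` on the
sector with `n` particles (`norm_pairDefectTilde_le`). The diagonal defect is negative, which gives
the bosonic bound `‖b*_k‖ ≤ √(n+1)` there (`norm_pairCreation_apply_le`).

Consequently `[b_k, B] = Ξ(k) b*_{-k} + e_k` (`generatorDefect`), where `e_k` adds exactly two
particles and both `e_k` and `e_k*` are bounded on the `n`-particle sector by `(n+2)^{3/2}` times
`∑_m |Ξ(m)| / (n_m n_k)`. Since operators that change the particle number by a fixed amount map
different sectors to orthogonal ones, these bounds combine to a bound by `‖(𝒩+2)^{3/2} ψ‖`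
(`HasDegree.enorm_apply_le`).

Along the flow, `u(s) = T(s)* b_k T(s) Ω` and `w(s) = T(s)* b*_{-k} T(s) Ω` solve `u' = Ξ(k) w + f`
and `w' = conj Ξ(k) u + g` with sources `f`, `g` coming from the defects. Without the sources this
is a hyperbolic rotation, and Duhamel's formula bounds the deviation at time `1` by `e^{|Ξ(k)|}`
times the size of the sources (`norm_sub_hyperbolic_rotation_le`). The `k`-th term of the energy is
a constant times `‖u(1)‖² + Re ⟨w(1), u(1)⟩`; inserting the approximate values, in which
`b_k Ω = 0` and `‖b*_{-k} Ω‖ = 1`, gives the leading term and the error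
(`abs_norm_sq_add_re_inner_sub_le`), which is then summed over `k`.
-/

namespace FermiGas

/-! ### The canonical anticommutation relations -/

theorem annihilation_apply (p : Momentum) (ψ : Fock) (S : Finset Momentum) :
    annihilation p ψ S = if p ∈ S then 0 else fermiSign p S * ψ (insert p S) := rfl

theorem lexLT_iff_not_of_ne {p q : Momentum} (h : p ≠ q) : lexLT p q ↔ ¬ lexLT q p := by
  have h' : ¬ (p 0 = q 0 ∧ p 1 = q 1 ∧ p 2 = q 2) := fun e => h <| by
    ext i
    fin_cases i
    exacts [e.1, e.2.1, e.2.2]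
  unfold lexLT
  omega

theorem fermiSign_mul_self (p : Momentum) (S : Finset Momentum) :
    fermiSign p S * fermiSign p S = 1 := by
  rw [fermiSign, ← mul_pow]
  simp

theorem fermiSign_insert (q : Momentum) {p : Momentum} {S : Finset Momentum} (hp : p ∉ S) :
    fermiSign q (insert p S) = (if lexLT p q then -1 else 1) * fermiSign q S := by
  unfold fermiSign
  rw [Finset.filter_insert]
  split_ifs with h
  · rw [Finset.card_insert_of_notMem (by simp [hp]), pow_succ']
  · simp

/-- The signs picked up by inserting `p` and `q` in the two possible orders are opposite. -/
theorem fermiSign_mul_fermiSign_insert {p q : Momentum} {S : Finset Momentum} (hpq : p ≠ q)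
    (hp : p ∉ S) (hq : q ∉ S) :
    fermiSign p S * fermiSign q (insert p S) = -(fermiSign q S * fermiSign p (insert q S)) := by
  rw [fermiSign_insert q hp, fermiSign_insert p hq]
  by_cases h : lexLT p q
  · have h' := (lexLT_iff_not_of_ne hpq).1 h
    simp [h, h', mul_comm]
  · have h' : lexLT q p := by
      by_contra h'
      exact h ((lexLT_iff_not_of_ne hpq).2 h')
    simp [h, h', mul_comm]

theorem annihilation_mul_annihilation (p q : Momentum) :
    annihilation p * annihilation q = -(annihilation q * annihilation p) := by
  ext ψ S
  change annihilation p (annihilation q ψ) S = -(annihilation q (annihilation p ψ) S)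
  simp only [annihilation_apply]
  by_cases hp : p ∈ S
  · simp [hp]
  by_cases hq : q ∈ S
  · simp [hq]
  by_cases hpq : p = q
  · subst hpq; simp
  have hqp : q ≠ p := Ne.symm hpq
  simp only [hp, hq, if_false, Finset.mem_insert, hpq, hqp, or_self]
  rw [← mul_assoc, ← mul_assoc, fermiSign_mul_fermiSign_insert hpq hp hq, Finset.insert_comm p q S]
  ring

theorem creation_mul_annihilation_self_apply (p : Momentum) (ψ : Fock) (S : Finset Momentum) :
    creation p (annihilation p ψ) S = if p ∈ S then ψ S else 0 := by
  rw [creation_apply]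
  split_ifs with h
  · rw [annihilation_apply, if_neg (by simp), Finset.insert_erase h, ← mul_assoc,
      fermiSign_mul_self, one_mul]
  · rfl

theorem annihilation_mul_creation (p q : Momentum) :
    annihilation p * creation q = (if p = q then 1 else 0) - creation q * annihilation p := by
  rw [eq_sub_iff_add_eq]
  ext ψ S
  by_cases hpq : p = q
  · subst hpq
    change annihilation p (creation p ψ) S + creation p (annihilation p ψ) S
      = (if p = p then (1 : Fock →L[ℂ] Fock) else 0) ψ S
    rw [if_pos rfl, creation_mul_annihilation_self_apply, annihilation_apply]
    by_cases h : p ∈ S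
    · simp [h]
    · simp [h, creation_apply, Finset.erase_insert h, ← mul_assoc, fermiSign_mul_self]
  · change annihilation p (creation q ψ) S + creation q (annihilation p ψ) S
      = (if p = q then (1 : Fock →L[ℂ] Fock) else 0) ψ S
    rw [if_neg hpq]
    change _ = (0 : ℂ)
    rw [annihilation_apply, creation_apply, creation_apply]
    by_cases hq : q ∈ S
    swap
    · have : q ∉ insert p S := by simp [hq, Ne.symm hpq]
      simp [hq, this]
    obtain ⟨R, hR, rfl⟩ : ∃ R, q ∉ R ∧ S = insert q R :=
      ⟨S.erase q, by simp, (Finset.insert_erase hq).symm⟩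
    by_cases hp : p ∈ R
    · simp [annihilation_apply, hp, Finset.erase_insert hR]
    have h1 : p ∉ insert q R := by simp [hp, hpq]
    have h2 : (insert p (insert q R)).erase q = insert p R := by
      rw [Finset.insert_comm, Finset.erase_insert (by simp [hR, Ne.symm hpq])]
    rw [if_neg h1, if_pos (by simp), if_pos (by simp), h2, Finset.erase_insert hR,
      annihilation_apply, if_neg hp, ← mul_assoc, ← mul_assoc, ← add_mul]
    have h3 : fermiSign p (insert q R) * fermiSign q (insert p R)
        = -(fermiSign q R * fermiSign p R) := by
      rw [fermiSign_insert p hR]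
      have := fermiSign_mul_fermiSign_insert hpq hp hR
      rw [fermiSign_insert p hR] at this
      have h4 : (if lexLT q p then (-1 : ℂ) else 1) * (if lexLT q p then (-1 : ℂ) else 1) = 1 := by
        split_ifs <;> norm_num
      linear_combination (if lexLT q p then (-1 : ℂ) else 1) * this
          - fermiSign q R * fermiSign p R * h4
    rw [h3]
    ring

theorem adjoint_creation (p : Momentum) :
    ContinuousLinearMap.adjoint (creation p) = annihilation p := by
  rw [creation, ContinuousLinearMap.adjoint_adjoint]

theorem star_creation (p : Momentum) : star (creation p) = annihilation p :=
  adjoint_creation p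

theorem star_annihilation (p : Momentum) : star (annihilation p) = creation p := rfl

theorem creation_mul_creation (p q : Momentum) :
    creation p * creation q = -(creation q * creation p) := by
  have := congrArg star (annihilation_mul_annihilation q p)
  simpa only [star_mul, star_neg, star_annihilation] using this

theorem annihilation_vacuum (p : Momentum) : annihilation p vacuum = 0 :=
  annihilation_single_of_notMem p ∅ (by simp)

/-! ### Commutators of the collective pair operators -/

/-- Pairs of creation operators are even, hence commute with each other. -/
theorem commute_creation_pair (p h q g : Momentum) :
    Commute (creation p * creation h) (creation q * creation g) := by
  have e : ∀ x y : Momentum, creation x * creation y = -(creation y * creation x) :=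
    creation_mul_creation
  change creation p * creation h * (creation q * creation g)
    = creation q * creation g * (creation p * creation h)
  calc creation p * creation h * (creation q * creation g)
      = creation p * (creation h * creation q) * creation g := by noncomm_ring
    _ = -(creation p * creation q) * (creation h * creation g) := by rw [e h q]; noncomm_ring
    _ = -(creation q * (creation p * creation g) * creation h) := by
      rw [e p q, e h g]; noncomm_ring
    _ = _ := by rw [e p g]; noncomm_ring

theorem commute_pairCreationTilde (BF : Finset Momentum) (k l : Momentum) :
    Commute (pairCreationTilde BF k) (pairCreationTilde BF l) :=
  Commute.sum_left _ _ _ fun _ _ => Commute.sum_right _ _ _ fun _ _ =>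
    commute_creation_pair _ _ _ _

/-- The holes `h` of the particle-hole pairs with relative momentum `k`. -/
def pairHoles (BF : Finset Momentum) (k : Momentum) : Finset Momentum :=
  BF.filter fun h => h + k ∉ BF

theorem mem_pairHoles {BF : Finset Momentum} {k h : Momentum} :
    h ∈ pairHoles BF k ↔ h ∈ BF ∧ h + k ∉ BF := Finset.mem_filter

theorem pairCreationTilde_eq (BF : Finset Momentum) (k : Momentum) :
    pairCreationTilde BF k = ∑ h ∈ pairHoles BF k, creation (h + k) * creation h := rfl

theorem pairAnnihilationTilde_eq (BF : Finset Momentum) (k : Momentum) :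
    pairAnnihilationTilde BF k
      = ∑ h ∈ pairHoles BF k, annihilation h * annihilation (h + k) := by
  change star (pairCreationTilde BF k) = _
  rw [pairCreationTilde_eq, star_sum]
  simp [star_mul, star_creation]

theorem commutator_pair {h p h' p' : Momentum} (h1 : h ≠ p') (h2 : p ≠ h') :
    annihilation h * annihilation p * (creation p' * creation h')
        - creation p' * creation h' * (annihilation h * annihilation p)
      = (if p = p' then 1 else 0) * (if h = h' then 1 else 0)
        - (if p = p' then 1 else 0) * (creation h' * annihilation h)
        - (if h = h' then 1 else 0) * (creation p' * annihilation p) := by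
  have e1 := annihilation_mul_creation h p'
  have e2 := annihilation_mul_creation p h'
  have e3 := annihilation_mul_creation p p'
  have e4 := annihilation_mul_creation h h'
  rw [if_neg h1, zero_sub] at e1
  rw [if_neg h2, zero_sub] at e2
  have comm : ∀ (P : Prop) [Decidable P] (A : Fock →L[ℂ] Fock),
      A * (if P then 1 else 0) = (if P then 1 else 0) * A := by
    intro P _ A; split_ifs <;> simp
  calc annihilation h * annihilation p * (creation p' * creation h')
        - creation p' * creation h' * (annihilation h * annihilation p)
      = annihilation h * (annihilation p * creation p') * creation h'
        - creation p' * creation h' * (annihilation h * annihilation p) := by noncomm_ring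
    _ = (annihilation h * (if p = p' then 1 else 0)) * creation h'
        - (annihilation h * creation p') * (annihilation p * creation h')
        - creation p' * creation h' * (annihilation h * annihilation p) := by
      rw [e3]; noncomm_ring
    _ = (if p = p' then 1 else 0) * (annihilation h * creation h')
        - creation p' * (annihilation h * creation h') * annihilation p
        - creation p' * creation h' * (annihilation h * annihilation p) := by
      rw [comm, e1, e2]; noncomm_ring
    _ = (if p = p' then 1 else 0) * (if h = h' then 1 else 0)
        - (if p = p' then 1 else 0) * (creation h' * annihilation h)
        - (creation p' * (if h = h' then 1 else 0)) * annihilation p := by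
      rw [e4]; noncomm_ring
    _ = _ := by rw [comm _ (creation p')]; noncomm_ring

/-- Off the diagonal, the commutator of `b̃_k` and `b̃*_l` consists of hole hoppings and particle
hoppings; on the diagonal it also contains the number of available pairs. -/
theorem commutator_pairTilde (BF : Finset Momentum) (k l : Momentum) :
    pairAnnihilationTilde BF k * pairCreationTilde BF l
        - pairCreationTilde BF l * pairAnnihilationTilde BF k
      = (if k = l then ((pairHoles BF k).card : Fock →L[ℂ] Fock) else 0)
        - ∑ h ∈ (pairHoles BF k).filter (fun h => h + k - l ∈ pairHoles BF l),
            creation (h + k - l) * annihilation h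
        - ∑ h ∈ pairHoles BF k ∩ pairHoles BF l, creation (h + l) * annihilation (h + k) := by
  have hL : pairAnnihilationTilde BF k * pairCreationTilde BF l
        - pairCreationTilde BF l * pairAnnihilationTilde BF k
      = ∑ h ∈ pairHoles BF k, ∑ h' ∈ pairHoles BF l,
          ((if h + k = h' + l then 1 else 0) * (if h = h' then 1 else 0)
          - (if h + k = h' + l then 1 else 0) * (creation h' * annihilation h)
          - (if h = h' then 1 else 0) * (creation (h' + l) * annihilation (h + k))) := by
    rw [pairAnnihilationTilde_eq, pairCreationTilde_eq, Finset.sum_mul_sum, Finset.sum_mul_sum,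
      Finset.sum_comm (s := pairHoles BF l), ← Finset.sum_sub_distrib]
    refine Finset.sum_congr rfl fun h hh => ?_
    rw [← Finset.sum_sub_distrib]
    refine Finset.sum_congr rfl fun h' hh' => ?_
    rw [mem_pairHoles] at hh hh'
    exact commutator_pair (fun e => hh'.2 (e ▸ hh.1)) (fun e => hh.2 (e ▸ hh'.1))
  rw [hL]
  simp only [Finset.sum_sub_distrib]
  congr 1
  · congr 1
    · simp only [← ite_and, ite_mul, one_mul, zero_mul]
      by_cases hkl : k = l
      · subst hkl
        simp
      · rw [if_neg hkl]
        refine Finset.sum_eq_zero fun h _ => Finset.sum_eq_zero fun h' _ => ?_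
        rw [if_neg]
        rintro ⟨h1, rfl⟩
        exact hkl (add_left_cancel h1)
    · rw [Finset.sum_filter]
      refine Finset.sum_congr rfl fun h _ => ?_
      simp only [ite_mul, one_mul, zero_mul]
      have : ∀ h', (h + k = h' + l) ↔ (h + k - l = h') := fun h' => sub_eq_iff_eq_add.symm
      simp only [this, Finset.sum_ite_eq]
  · rw [← Finset.filter_mem_eq_inter, Finset.sum_filter]
    refine Finset.sum_congr rfl fun h _ => ?_
    simp only [ite_mul, one_mul, zero_mul, Finset.sum_ite_eq]

theorem pairAnnihilationTilde_vacuum (BF : Finset Momentum) (k : Momentum) :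
    pairAnnihilationTilde BF k vacuum = 0 := by
  rw [pairAnnihilationTilde_eq, sum_apply]
  refine Finset.sum_eq_zero fun h _ => ?_
  change annihilation h (annihilation (h + k) vacuum) = 0
  rw [annihilation_vacuum, map_zero]

theorem norm_vacuum : ‖vacuum‖ = 1 := by
  simp [vacuum, lp.norm_single]

/-- `n_k²` counts the particle-hole pairs of relative momentum `k`. -/
theorem pairNorm_sq (BF : Finset Momentum) (k : Momentum) :
    pairNorm BF k ^ 2 = (pairHoles BF k).card := by
  have hcomm := congrArg (fun A : Fock →L[ℂ] Fock => A vacuum) (commutator_pairTilde BF k k)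
  have hv : pairAnnihilationTilde BF k (pairCreationTilde BF k vacuum)
      = ((pairHoles BF k).card : ℂ) • vacuum := by
    simpa [sum_apply, annihilation_vacuum, pairAnnihilationTilde_vacuum,
      Nat.cast_smul_eq_nsmul] using hcomm
  have h1 : ((pairNorm BF k ^ 2 : ℝ) : ℂ) = ((pairHoles BF k).card : ℝ) := by
    have := inner_self_eq_norm_sq_to_K (𝕜 := ℂ) (pairCreationTilde BF k vacuum)
    rw [← ContinuousLinearMap.adjoint_inner_right] at this
    change inner ℂ vacuum (pairAnnihilationTilde BF k (pairCreationTilde BF k vacuum)) = _ at this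
    rw [hv, inner_smul_right, inner_self_eq_norm_sq_to_K, norm_vacuum] at this
    simpa [pairNorm] using this.symm
  exact_mod_cast h1

theorem card_pairHoles_neg (BF : Finset Momentum) (k : Momentum) :
    (pairHoles BF (-k)).card = (pairHoles BF k).card := by
  have h1 : (BF.filter fun h => h + k ∈ BF).card = (BF.filter fun h => h + -k ∈ BF).card := by
    refine Finset.card_bij' (fun h _ => h + k) (fun h _ => h + -k) ?_ ?_ ?_ ?_ <;>
      simp +contextual
  have h2 := Finset.card_filter_add_card_filter_not (s := BF) (fun h => h + k ∈ BF)
  have h3 := Finset.card_filter_add_card_filter_not (s := BF) (fun h => h + -k ∈ BF)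
  unfold pairHoles
  omega

theorem pairNorm_nonneg (BF : Finset Momentum) (k : Momentum) : 0 ≤ pairNorm BF k :=
  norm_nonneg _

theorem pairNorm_neg (BF : Finset Momentum) (k : Momentum) :
    pairNorm BF (-k) = pairNorm BF k := by
  rw [← sq_eq_sq₀ (pairNorm_nonneg _ _) (pairNorm_nonneg _ _), pairNorm_sq, pairNorm_sq,
    card_pairHoles_neg]

/-! ### Particle number sectors -/

theorem norm_sq_eq_tsum (ψ : Fock) : ‖ψ‖ ^ 2 = ∑' S, ‖ψ S‖ ^ 2 := by
  have := lp.norm_rpow_eq_tsum (p := 2) (by norm_num) ψ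
  simpa using this

theorem summable_norm_sq (ψ : Fock) : Summable fun S => ‖ψ S‖ ^ 2 := by
  have := (lp.memℓp ψ).summable (by norm_num)
  simpa using this

theorem norm_le_norm_of_forall {ψ φ : Fock} {c : ℝ} (hc : 0 ≤ c)
    (h : ∀ S, ‖ψ S‖ ≤ c * ‖φ S‖) : ‖ψ‖ ≤ c * ‖φ‖ := by
  rw [← sq_le_sq₀ (norm_nonneg _) (by positivity), mul_pow, norm_sq_eq_tsum, norm_sq_eq_tsum,
    ← tsum_mul_left]
  refine (summable_norm_sq ψ).tsum_le_tsum (fun S => ?_) ((summable_norm_sq φ).mul_left _)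
  rw [← mul_pow]
  exact pow_le_pow_left₀ (norm_nonneg _) (h S) 2

theorem memℓp_sector (n : ℤ) (ψ : Fock) :
    Memℓp (fun S : Finset Momentum => if (S.card : ℤ) = n then ψ S else 0) 2 := by
  refine memℓp_gen' (C := ‖ψ‖ ^ (2 : ℝ≥0∞).toReal) fun s => ?_
  refine le_trans (Finset.sum_le_sum fun S _ => ?_) (lp.sum_rpow_le_norm_rpow (by norm_num) ψ s)
  refine Real.rpow_le_rpow (norm_nonneg _) ?_ (by norm_num)
  split_ifs <;> simp

/-- The projection onto the sector of particle number `n`. Integer labels (negative sectors are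
trivial) let operators that remove particles be treated like those that add some. -/
noncomputable def sectorProj (n : ℤ) : Fock →L[ℂ] Fock :=
  LinearMap.mkContinuous
    { toFun := fun ψ => ⟨_, memℓp_sector n ψ⟩
      map_add' := by
        intro ψ φ
        ext S
        change (if (S.card : ℤ) = n then ψ S + φ S else 0)
          = (if (S.card : ℤ) = n then ψ S else 0) + (if (S.card : ℤ) = n then φ S else 0)
        split_ifs <;> simp
      map_smul' := by
        intro c ψ
        ext S
        change (if (S.card : ℤ) = n then c * ψ S else 0)
          = c * (if (S.card : ℤ) = n then ψ S else 0)
        split_ifs <;> simp }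
    1 (by
      intro ψ
      refine norm_le_norm_of_forall zero_le_one fun S => ?_
      change ‖if (S.card : ℤ) = n then ψ S else 0‖ ≤ _
      split_ifs <;> simp)

theorem sectorProj_apply (n : ℤ) (ψ : Fock) (S : Finset Momentum) :
    sectorProj n ψ S = if (S.card : ℤ) = n then ψ S else 0 := rfl

theorem sectorProj_idem (n : ℤ) (ψ : Fock) : sectorProj n (sectorProj n ψ) = sectorProj n ψ := by
  ext S
  simp +contextual [sectorProj_apply]

theorem star_sectorProj (n : ℤ) : star (sectorProj n) = sectorProj n := by
  rw [ContinuousLinearMap.star_eq_adjoint, eq_comm, ContinuousLinearMap.eq_adjoint_iff]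
  intro ψ φ
  rw [lp.inner_eq_tsum, lp.inner_eq_tsum]
  refine tsum_congr fun S => ?_
  rw [sectorProj_apply, sectorProj_apply]
  split_ifs <;> simp

theorem sectorProj_of_neg {n : ℤ} (hn : n < 0) : sectorProj n = 0 := by
  ext ψ S
  rw [sectorProj_apply, if_neg (by omega)]
  rfl

/-- `A` changes the particle number by exactly `d`. -/
def HasDegree (d : ℤ) (A : Fock →L[ℂ] Fock) : Prop :=
  ∀ n, sectorProj (n + d) * A = A * sectorProj n

theorem HasDegree.apply {d : ℤ} {A : Fock →L[ℂ] Fock} (h : HasDegree d A) (n : ℤ) (ψ : Fock) :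
    sectorProj (n + d) (A ψ) = A (sectorProj n ψ) :=
  congrArg (fun C : Fock →L[ℂ] Fock => C ψ) (h n)

theorem HasDegree.apply_of_eq {d : ℤ} {A : Fock →L[ℂ] Fock} (h : HasDegree d A) {n m : ℤ}
    {ψ : Fock} (hψ : sectorProj n ψ = ψ) (hm : m = n + d) : sectorProj m (A ψ) = A ψ := by
  rw [hm, h.apply, hψ]

theorem HasDegree.mul {d e f : ℤ} {A C : Fock →L[ℂ] Fock} (hA : HasDegree d A)
    (hC : HasDegree e C) (hf : f = e + d) : HasDegree f (A * C) := fun n => by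
  rw [hf, ← add_assoc, ← mul_assoc, hA, mul_assoc, hC, mul_assoc]

theorem HasDegree.add {d : ℤ} {A C : Fock →L[ℂ] Fock} (hA : HasDegree d A)
    (hC : HasDegree d C) : HasDegree d (A + C) := fun n => by
  rw [mul_add, add_mul, hA, hC]

theorem HasDegree.sub {d : ℤ} {A C : Fock →L[ℂ] Fock} (hA : HasDegree d A)
    (hC : HasDegree d C) : HasDegree d (A - C) := fun n => by
  rw [mul_sub, sub_mul, hA, hC]

theorem HasDegree.smul {d : ℤ} {A : Fock →L[ℂ] Fock} (c : ℂ) (hA : HasDegree d A) :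
    HasDegree d (c • A) := fun n => by
  rw [mul_smul_comm, smul_mul_assoc, hA]

theorem HasDegree.sum {ι : Type*} {d : ℤ} {s : Finset ι} {A : ι → Fock →L[ℂ] Fock}
    (hA : ∀ i ∈ s, HasDegree d (A i)) : HasDegree d (∑ i ∈ s, A i) := fun n => by
  rw [Finset.mul_sum, Finset.sum_mul]
  exact Finset.sum_congr rfl fun i hi => hA i hi n

theorem HasDegree.of_hasSum {ι : Type*} {d : ℤ} {A : ι → Fock →L[ℂ] Fock} {C : Fock →L[ℂ] Fock}
    (hA : ∀ i, HasDegree d (A i)) (h : HasSum A C) : HasDegree d C := fun n => by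
  have h1 := h.mul_left (sectorProj (n + d))
  have h2 := h.mul_right (sectorProj n)
  rw [show (fun i => sectorProj (n + d) * A i) = fun i => A i * sectorProj n from
    funext fun i => hA i n] at h1
  exact h1.unique h2

theorem HasDegree.star {d : ℤ} {A : Fock →L[ℂ] Fock} (hA : HasDegree d A) :
    HasDegree (-d) (star A) := fun n => by
  have := congrArg Star.star (hA (n - d))
  rw [star_mul, star_mul, star_sectorProj, star_sectorProj, sub_add_cancel] at this
  rw [← sub_eq_add_neg, ← this]

theorem hasDegree_annihilation (p : Momentum) : HasDegree (-1) (annihilation p) := fun n => by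
  ext ψ S
  change sectorProj (n + -1) (annihilation p ψ) S = annihilation p (sectorProj n ψ) S
  rw [sectorProj_apply, annihilation_apply, annihilation_apply, sectorProj_apply]
  by_cases hp : p ∈ S
  · simp [hp]
  · have : ((S.card : ℤ) = n + -1) ↔ (((insert p S).card : ℤ) = n) := by
      rw [Finset.card_insert_of_notMem hp]
      push_cast
      omega
    simp [hp, this]

theorem hasDegree_creation (p : Momentum) : HasDegree 1 (creation p) := by
  simpa [star_annihilation] using (hasDegree_annihilation p).star

theorem hasDegree_pairCreationTilde (BF : Finset Momentum) (k : Momentum) :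
    HasDegree 2 (pairCreationTilde BF k) :=
  HasDegree.sum fun _ _ => (hasDegree_creation _).mul (hasDegree_creation _) rfl

/-! ### Operator bounds on the sectors -/

/-- Summing the occupation numbers of finitely many modes gives at most the particle number. -/
theorem sum_norm_sq_annihilation_le {ι : Type*} (I : Finset ι) (f : ι → Momentum)
    (hf : Set.InjOn f I) {n : ℕ} {ψ : Fock} (hψ : sectorProj n ψ = ψ) :
    ∑ i ∈ I, ‖annihilation (f i) ψ‖ ^ 2 ≤ n * ‖ψ‖ ^ 2 := by
  classical
  set φ : Fock := ∑ i ∈ I, creation (f i) (annihilation (f i) ψ) with hφ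
  have h1 : ∑ i ∈ I, ‖annihilation (f i) ψ‖ ^ 2 = (inner ℂ ψ φ : ℂ).re := by
    rw [hφ, inner_sum, Complex.re_sum]
    refine Finset.sum_congr rfl fun i _ => ?_
    rw [creation, ContinuousLinearMap.adjoint_inner_right, inner_self_eq_norm_sq_to_K]
    norm_cast
  have h2 : ‖φ‖ ≤ n * ‖ψ‖ := by
    refine norm_le_norm_of_forall (Nat.cast_nonneg n) fun S => ?_
    have hS : φ S = ((I.filter fun i => f i ∈ S).card : ℂ) * ψ S := by
      rw [hφ, lp.coeFn_sum, Finset.sum_apply]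
      simp only [creation_mul_annihilation_self_apply]
      rw [← Finset.sum_filter, Finset.sum_const, nsmul_eq_mul]
    have hψS : ψ S = if (S.card : ℤ) = n then ψ S else 0 := by
      rw [← sectorProj_apply, hψ]
    rw [hS, norm_mul, Complex.norm_natCast]
    split_ifs at hψS with hc
    · refine mul_le_mul_of_nonneg_right ?_ (norm_nonneg _)
      have hcard : (I.filter fun i => f i ∈ S).card ≤ S.card :=
        Finset.card_le_card_of_injOn f (fun i hi => (Finset.mem_filter.1 hi).2)
          (hf.mono fun i hi => (Finset.mem_filter.1 hi).1)
      have : S.card = n := by exact_mod_cast hc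
      exact_mod_cast this ▸ hcard
    · simp [hψS]
  rw [h1]
  calc (inner ℂ ψ φ : ℂ).re ≤ ‖ψ‖ * ‖φ‖ := re_inner_le_norm (𝕜 := ℂ) ψ φ
    _ ≤ ‖ψ‖ * (n * ‖ψ‖) := mul_le_mul_of_nonneg_left h2 (norm_nonneg _)
    _ = n * ‖ψ‖ ^ 2 := by ring

/-- A sum of hoppings `a*_{f(i)} a_{g(i)}` with `f` and `g` injective is bounded by the particle
number, since it is the second quantization of a partial isometry. -/
theorem norm_sum_hopping_le {ι : Type*} (I : Finset ι) (f g : ι → Momentum)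
    (hf : Set.InjOn f I) (hg : Set.InjOn g I) {n : ℕ} {ψ : Fock} (hψ : sectorProj n ψ = ψ) :
    ‖(∑ i ∈ I, creation (f i) * annihilation (g i)) ψ‖ ≤ n * ‖ψ‖ := by
  set A : Fock →L[ℂ] Fock := ∑ i ∈ I, creation (f i) * annihilation (g i) with hA
  set φ : Fock := A ψ with hφ
  have hdeg : HasDegree 0 A :=
    HasDegree.sum fun i _ => (hasDegree_creation _).mul (hasDegree_annihilation _) (by norm_num)
  have hφn : sectorProj n φ = φ := hdeg.apply_of_eq hψ (by simp)
  have h1 : ‖φ‖ ^ 2 ≤ ∑ i ∈ I, ‖annihilation (f i) φ‖ * ‖annihilation (g i) ψ‖ := by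
    have h0 : ∀ χ : Fock, (inner ℂ χ φ : ℂ)
        = ∑ i ∈ I, inner ℂ (annihilation (f i) χ) (annihilation (g i) ψ) := fun χ => by
      rw [hφ, hA, sum_apply, inner_sum]
      refine Finset.sum_congr rfl fun i _ => ?_
      change inner ℂ _ (creation (f i) (annihilation (g i) ψ)) = _
      rw [creation, ContinuousLinearMap.adjoint_inner_right]
    have h2 : ‖φ‖ ^ 2 = ‖(inner ℂ φ φ : ℂ)‖ := by
      rw [inner_self_eq_norm_sq_to_K]; simp
    rw [h2, h0]
    exact (norm_sum_le _ _).trans (Finset.sum_le_sum fun i _ => norm_inner_le_norm _ _)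
  have h2 : (‖φ‖ ^ 2) ^ 2 ≤ (n * ‖φ‖ ^ 2) * (n * ‖ψ‖ ^ 2) := by
    refine (pow_le_pow_left₀ (by positivity) h1 2).trans ?_
    refine (Finset.sum_mul_sq_le_sq_mul_sq I _ _).trans ?_
    exact mul_le_mul (sum_norm_sq_annihilation_le I f hf hφn)
      (sum_norm_sq_annihilation_le I g hg hψ) (by positivity) (by positivity)
  by_cases h0 : ‖φ‖ = 0
  · rw [h0]; positivity
  · have hpos : 0 < ‖φ‖ := lt_of_le_of_ne (norm_nonneg _) (Ne.symm h0)
    rw [← sq_le_sq₀ hpos.le (by positivity)]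
    refine le_of_mul_le_mul_left ?_ (pow_pos hpos 2)
    calc ‖φ‖ ^ 2 * ‖φ‖ ^ 2 = (‖φ‖ ^ 2) ^ 2 := by ring
      _ ≤ _ := h2
      _ = _ := by ring

/-- The deviation `[b̃_k, b̃*_l] - δ_{kl} n_k²` from the bosonic commutation relations. -/
noncomputable def pairDefectTilde (BF : Finset Momentum) (k l : Momentum) : Fock →L[ℂ] Fock :=
  pairAnnihilationTilde BF k * pairCreationTilde BF l
    - pairCreationTilde BF l * pairAnnihilationTilde BF k
    - (if k = l then ((pairHoles BF k).card : Fock →L[ℂ] Fock) else 0)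

/-- Holes hop inside and particles hop outside `BF`, so that both families of hoppings together
still have injective start and end points. -/
theorem norm_pairDefectTilde_le (BF : Finset Momentum) (k l : Momentum) {n : ℕ} {ψ : Fock}
    (hψ : sectorProj n ψ = ψ) : ‖pairDefectTilde BF k l ψ‖ ≤ n * ‖ψ‖ := by
  set I := (pairHoles BF k).filter (fun h => h + k - l ∈ pairHoles BF l)
  set J := pairHoles BF k ∩ pairHoles BF l
  have hI : ∀ h ∈ I, h ∈ BF ∧ h + k - l ∈ BF := fun h hh =>
    ⟨(mem_pairHoles.1 (Finset.mem_filter.1 hh).1).1, (mem_pairHoles.1 (Finset.mem_filter.1 hh).2).1⟩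
  have hJ : ∀ h ∈ J, h + k ∉ BF ∧ h + l ∉ BF := fun h hh =>
    ⟨(mem_pairHoles.1 (Finset.mem_inter.1 hh).1).2, (mem_pairHoles.1 (Finset.mem_inter.1 hh).2).2⟩
  have hD : pairDefectTilde BF k l = -∑ x ∈ I.disjSum J,
      creation (Sum.elim (fun h => h + k - l) (fun h => h + l) x)
        * annihilation (Sum.elim (fun h => h) (fun h => h + k) x) := by
    rw [pairDefectTilde, commutator_pairTilde, Finset.sum_disjSum]
    simp only [Sum.elim_inl, Sum.elim_inr]
    abel
  have hf : Set.InjOn (Sum.elim (fun h : Momentum => h + k - l) (fun h : Momentum => h + l))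
      (I.disjSum J : Finset (Momentum ⊕ Momentum)) := by
    rintro (a | a) ha (b | b) hb hab <;> simp only [Finset.mem_coe, Finset.inl_mem_disjSum,
      Finset.inr_mem_disjSum, Sum.elim_inl, Sum.elim_inr] at ha hb hab
    · simpa using hab
    · exact absurd (hab ▸ (hI a ha).2) (hJ b hb).2
    · exact absurd (hab ▸ (hI b hb).2) (hJ a ha).2
    · simpa using hab
  have hg : Set.InjOn (Sum.elim (fun h : Momentum => h) (fun h : Momentum => h + k))
      (I.disjSum J : Finset (Momentum ⊕ Momentum)) := by
    rintro (a | a) ha (b | b) hb hab <;> simp only [Finset.mem_coe, Finset.inl_mem_disjSum,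
      Finset.inr_mem_disjSum, Sum.elim_inl, Sum.elim_inr] at ha hb hab
    · simpa using hab
    · exact absurd (hab ▸ (hI a ha).1) (hJ b hb).1
    · exact absurd (hab ▸ (hI b hb).1) (hJ a ha).1
    · simpa using hab
  rw [hD, neg_apply, norm_neg]
  exact norm_sum_hopping_le _ _ _ hf hg hψ

theorem norm_sq_pairAnnihilationTilde_le (BF : Finset Momentum) (k : Momentum) {n : ℕ} {ψ : Fock}
    (hψ : sectorProj n ψ = ψ) :
    ‖pairAnnihilationTilde BF k ψ‖ ^ 2 ≤ pairNorm BF k ^ 2 * (n * ‖ψ‖ ^ 2) := by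
  have h1 : ‖pairAnnihilationTilde BF k ψ‖
      ≤ ∑ h ∈ pairHoles BF k, 1 * ‖annihilation (h + k) ψ‖ := by
    rw [pairAnnihilationTilde_eq, sum_apply]
    refine (norm_sum_le _ _).trans (Finset.sum_le_sum fun h _ => ?_)
    exact (annihilation h).le_of_opNorm_le (norm_annihilation_le h) _
  refine (pow_le_pow_left₀ (norm_nonneg _) h1 2).trans ?_
  refine (Finset.sum_mul_sq_le_sq_mul_sq _ _ _).trans ?_
  rw [pairNorm_sq]
  refine mul_le_mul (by simp) ?_ (by positivity) (by positivity)
  exact sum_norm_sq_annihilation_le _ (fun h => h + k) (fun a _ b _ h => add_right_cancel h) hψ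

/-- The defect on the diagonal is negative, so that `b̃*_k` obeys the same bound as a bosonic
creation operator. -/
theorem norm_sq_pairCreationTilde_le (BF : Finset Momentum) (k : Momentum) {n : ℕ} {ψ : Fock}
    (hψ : sectorProj n ψ = ψ) :
    ‖pairCreationTilde BF k ψ‖ ^ 2 ≤ pairNorm BF k ^ 2 * ((n + 1) * ‖ψ‖ ^ 2) := by
  have hsq : ∀ φ : Fock, (inner ℂ φ φ : ℂ).re = ‖φ‖ ^ 2 := fun φ => by
    rw [inner_self_eq_norm_sq_to_K]; norm_cast
  have hcr : ∀ p q : Momentum, ∀ φ χ : Fock,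
      (inner ℂ φ ((creation p * annihilation q) χ) : ℂ)
        = inner ℂ (annihilation p φ) (annihilation q χ) := fun p q φ χ => by
    change inner ℂ φ (creation p (annihilation q χ)) = _
    rw [creation, ContinuousLinearMap.adjoint_inner_right]
  have h := congrArg (fun A : Fock →L[ℂ] Fock => (inner ℂ ψ (A ψ) : ℂ).re)
    (commutator_pairTilde BF k k)
  simp only [sub_apply, inner_sub_right, Complex.sub_re, sum_apply, inner_sum, Complex.re_sum,
    if_true, hcr, add_sub_cancel_right, hsq] at h
  have e1 : (inner ℂ ψ ((pairAnnihilationTilde BF k * pairCreationTilde BF k) ψ) : ℂ).re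
      = ‖pairCreationTilde BF k ψ‖ ^ 2 := by
    change (inner ℂ ψ (pairAnnihilationTilde BF k (pairCreationTilde BF k ψ)) : ℂ).re = _
    rw [pairAnnihilationTilde, ContinuousLinearMap.adjoint_inner_right, hsq]
  have e2 : (inner ℂ ψ ((pairCreationTilde BF k * pairAnnihilationTilde BF k) ψ) : ℂ).re
      = ‖pairAnnihilationTilde BF k ψ‖ ^ 2 := by
    change (inner ℂ ψ (pairCreationTilde BF k (pairAnnihilationTilde BF k ψ)) : ℂ).re = _
    rw [← ContinuousLinearMap.adjoint_inner_left]
    exact hsq _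
  have e3 : (inner ℂ ψ (((pairHoles BF k).card : Fock →L[ℂ] Fock) ψ) : ℂ).re
      = pairNorm BF k ^ 2 * ‖ψ‖ ^ 2 := by
    have : ((pairHoles BF k).card : Fock →L[ℂ] Fock) ψ = ((pairHoles BF k).card : ℂ) • ψ := by
      simp [Nat.cast_smul_eq_nsmul]
    rw [this, inner_smul_right, pairNorm_sq, ← Complex.ofReal_natCast, Complex.re_ofReal_mul, hsq]
  rw [e1, e2, e3] at h
  have h1 := norm_sq_pairAnnihilationTilde_le BF k hψ
  have p1 : 0 ≤ ∑ h ∈ (pairHoles BF k).filter (fun h => h ∈ pairHoles BF k),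
      ‖annihilation h ψ‖ ^ 2 :=
    Finset.sum_nonneg fun _ _ => sq_nonneg _
  have p2 : 0 ≤ ∑ h ∈ pairHoles BF k ∩ pairHoles BF k, ‖annihilation (h + k) ψ‖ ^ 2 :=
    Finset.sum_nonneg fun _ _ => sq_nonneg _
  linarith

/-! ### Number-weighted norms -/

theorem enorm_sq_eq_tsum (ψ : Fock) : ‖ψ‖ₑ ^ 2 = ∑' S, ‖ψ S‖ₑ ^ 2 := by
  have h : ∀ x : ℝ, 0 ≤ x → ENNReal.ofReal x ^ 2 = ENNReal.ofReal (x ^ 2) := fun x hx =>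
    (ENNReal.ofReal_pow hx 2).symm
  rw [← ofReal_norm, h _ (norm_nonneg _), norm_sq_eq_tsum,
    ENNReal.ofReal_tsum_of_nonneg (fun S => sq_nonneg _) (summable_norm_sq ψ)]
  refine tsum_congr fun S => ?_
  rw [← ofReal_norm, h _ (norm_nonneg _)]

theorem numberNorm_sq (f : ℕ → ℝ) (ψ : Fock) :
    numberNorm f ψ ^ 2 = ∑' S, ‖(f S.card : ℂ) * ψ S‖ₑ ^ 2 := by
  rw [numberNorm, ← ENNReal.rpow_natCast, ← ENNReal.rpow_mul]
  norm_num

theorem tsum_mul_enorm_sectorProj_sq (g : ℤ → ℝ≥0∞) (ψ : Fock) :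
    ∑' n, g n * ‖sectorProj n ψ‖ₑ ^ 2 = ∑' S : Finset Momentum, g S.card * ‖ψ S‖ₑ ^ 2 := by
  simp only [enorm_sq_eq_tsum, ← ENNReal.tsum_mul_left]
  rw [ENNReal.tsum_comm]
  refine tsum_congr fun S => ?_
  rw [tsum_eq_single (S.card : ℤ)]
  · rw [sectorProj_apply, if_pos rfl]
  · intro n hn
    rw [sectorProj_apply, if_neg (Ne.symm hn)]
    simp

/-- Different sectors are mapped to orthogonal ones, so bounds on the sectors combine to a bound by
a number-weighted norm. -/
theorem HasDegree.enorm_apply_le {d : ℤ} {A : Fock →L[ℂ] Fock} (hA : HasDegree d A) {c : ℝ}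
    (hc : 0 ≤ c) {f : ℕ → ℝ} (hf : ∀ n, 0 ≤ f n)
    (hbound : ∀ (n : ℕ) (φ : Fock), sectorProj n φ = φ → ‖A φ‖ ≤ c * f n * ‖φ‖) (ψ : Fock) :
    ‖A ψ‖ₑ ≤ ENNReal.ofReal c * numberNorm f ψ := by
  rw [← ENNReal.pow_le_pow_left_iff two_ne_zero, mul_pow, numberNorm_sq]
  have h1 : ‖A ψ‖ₑ ^ 2 = ∑' n : ℤ, ‖A (sectorProj n ψ)‖ₑ ^ 2 := by
    rw [enorm_sq_eq_tsum]
    have := tsum_mul_enorm_sectorProj_sq (fun _ => 1) (A ψ)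
    simp only [one_mul] at this
    rw [← this, ← (Equiv.addRight d).tsum_eq]
    simp only [Equiv.coe_addRight, hA.apply]
  have h2 : ∀ n : ℤ, ‖A (sectorProj n ψ)‖ₑ ^ 2
      ≤ ENNReal.ofReal (c * f n.toNat) ^ 2 * ‖sectorProj n ψ‖ₑ ^ 2 := by
    intro n
    rw [← mul_pow]
    refine pow_le_pow_left₀ zero_le ?_ 2
    obtain hn | hn := lt_or_ge n 0
    · simp [sectorProj_of_neg hn]
    · lift n to ℕ using hn
      have := hbound n _ (sectorProj_idem n ψ)
      rw [← ofReal_norm, ← ofReal_norm, ← ENNReal.ofReal_mul (mul_nonneg hc (hf _))]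
      exact ENNReal.ofReal_le_ofReal this
  rw [h1]
  refine (ENNReal.tsum_le_tsum h2).trans ?_
  rw [tsum_mul_enorm_sectorProj_sq (fun n => ENNReal.ofReal (c * f n.toNat) ^ 2),
    ← ENNReal.tsum_mul_left]
  refine ENNReal.tsum_le_tsum fun S => le_of_eq ?_
  have : ‖((f S.card : ℝ) : ℂ)‖ₑ = ENNReal.ofReal (f S.card) := by
    rw [← ofReal_norm, Complex.norm_real, Real.norm_of_nonneg (hf _)]
  rw [Int.toNat_natCast, ENNReal.ofReal_mul hc, enorm_mul, this]
  ring

theorem supNumberNorm_sq_le (BF : Finset Momentum) (Ξ : Momentum → ℂ) :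
    supNumberNorm BF Ξ ^ 2 ≤ supNumberExpect BF Ξ := by
  have h : ∀ t ∈ Set.Icc (0 : ℝ) 1,
      numberNorm (fun j => ((j : ℝ) + 2) ^ (3 / 2 : ℝ)) (trialState BF Ξ t) ^ 2
        ≤ supNumberExpect BF Ξ := by
    intro t ht
    refine le_trans (le_of_eq ?_) (le_iSup₂ (f := fun t (_ : t ∈ Set.Icc (0 : ℝ) 1) =>
      numberExpect (fun j => ((j : ℝ) + 2) ^ 3) (trialState BF Ξ t)) t ht)
    rw [numberNorm_sq, numberExpect]
    refine tsum_congr fun S => ?_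
    have h0 : (0 : ℝ) ≤ (S.card : ℝ) + 2 := by positivity
    rw [enorm_mul, mul_pow, ← ofReal_norm (((((S.card : ℝ) + 2) ^ (3 / 2 : ℝ) : ℝ) : ℂ)),
      Complex.norm_real, Real.norm_of_nonneg (by positivity),
      ← ENNReal.ofReal_pow (by positivity), ← Real.rpow_natCast, ← Real.rpow_mul h0]
    norm_num
  have hsqrt : ∀ x : ℝ≥0∞, (x ^ 2) ^ (1 / 2 : ℝ) = x := fun x => by
    rw [← ENNReal.rpow_natCast, ← ENNReal.rpow_mul]
    norm_num
  have h' : supNumberNorm BF Ξ ≤ supNumberExpect BF Ξ ^ (1 / 2 : ℝ) := iSup₂_le fun t ht => by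
    rw [← hsqrt (numberNorm _ _)]
    exact ENNReal.rpow_le_rpow (h t ht) (by norm_num)
  refine (pow_le_pow_left₀ zero_le h' 2).trans (le_of_eq ?_)
  rw [← ENNReal.rpow_natCast, ← ENNReal.rpow_mul]
  norm_num

/-! ### Perturbed hyperbolic rotation -/

/-- Duhamel's formula for `u' = z w`, `w' = z̄ u`, whose solution is a hyperbolic rotation: sources
of size `Y` change the value at time `1` by at most `e^|z| Y`. -/
theorem norm_sub_hyperbolic_rotation_le {E : Type*} [NormedAddCommGroup E] [NormedSpace ℂ E]
    (z : ℂ) (u w f g : ℝ → E) (Y : ℝ)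
    (hu : ∀ s, HasDerivAt u (z • w s + f s) s)
    (hw : ∀ s, HasDerivAt w (starRingEnd ℂ z • u s + g s) s)
    (hf : ∀ s ∈ Set.Icc (0 : ℝ) 1, ‖f s‖ ≤ Y) (hg : ∀ s ∈ Set.Icc (0 : ℝ) 1, ‖g s‖ ≤ Y) :
    ‖u 1 - ((Real.cosh ‖z‖ : ℂ) • u 0 + (z / (‖z‖ : ℂ) * (Real.sinh ‖z‖ : ℂ)) • w 0)‖
      ≤ Real.exp ‖z‖ * Y := by
  set r := ‖z‖ with hr
  set ω : ℂ := z / (r : ℂ) with hω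
  have hωz : ω * starRingEnd ℂ z = r := by
    by_cases h0 : z = 0
    · simp [h0, hr]
    · have : (r : ℂ) ≠ 0 := by simpa [hr] using h0
      rw [hω, div_mul_eq_mul_div, Complex.mul_conj, Complex.normSq_eq_norm_sq, ← hr]
      push_cast
      field_simp
  have hωr : ω * r = z := by
    by_cases h0 : z = 0
    · simp [h0, hr, hω]
    · have : (r : ℂ) ≠ 0 := by simpa [hr] using h0
      rw [hω]
      field_simp
  have hωn : ‖ω‖ ≤ 1 := by
    rw [hω, norm_div, Complex.norm_real, Real.norm_of_nonneg (norm_nonneg z)]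
    exact div_self_le_one _
  -- The backward propagator applied to `(u, w)` removes the homogeneous part of the equation.
  set F : ℝ → E := fun s => (Real.cosh ((1 - s) * r) : ℂ) • u s
    + (ω * (Real.sinh ((1 - s) * r) : ℂ)) • w s with hF
  have hlin : ∀ s : ℝ, HasDerivAt (fun s : ℝ => (1 - s) * r) (-r) s := fun s => by
    simpa using ((hasDerivAt_id s).const_sub 1).mul_const r
  have hder : ∀ s, HasDerivAt F ((Real.cosh ((1 - s) * r) : ℂ) • f s
      + (ω * (Real.sinh ((1 - s) * r) : ℂ)) • g s) s := fun s => by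
    have h1 := ((hlin s).cosh.ofReal_comp).smul (hu s)
    have h2 := (((hlin s).sinh.ofReal_comp).const_mul ω).smul (hw s)
    refine (h1.add h2).congr_deriv ?_
    push_cast
    rw [← hωr]
    have e : ω * Complex.sinh ((1 - s) * r) * starRingEnd ℂ (ω * r)
        = r * Complex.sinh ((1 - s) * r) := by
      rw [hωr, mul_right_comm, hωz]
    simp only [smul_add, smul_smul, e]
    module
  have hexp : ∀ s ∈ Set.Icc (0 : ℝ) 1, ‖(Real.cosh ((1 - s) * r) : ℂ) • f s
      + (ω * (Real.sinh ((1 - s) * r) : ℂ)) • g s‖ ≤ Real.exp r * Y := fun s hs => by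
    have hr0 : 0 ≤ r := norm_nonneg z
    have hx : 0 ≤ (1 - s) * r := mul_nonneg (by linarith [hs.2]) hr0
    have hY : 0 ≤ Y := (norm_nonneg _).trans (hf s hs)
    have hsinh : 0 ≤ Real.sinh ((1 - s) * r) := Real.sinh_nonneg_iff.2 hx
    calc _ ≤ Real.cosh ((1 - s) * r) * Y + 1 * Real.sinh ((1 - s) * r) * Y := by
          refine (norm_add_le _ _).trans (add_le_add ?_ ?_)
          · rw [norm_smul, Complex.norm_real, Real.norm_of_nonneg (Real.cosh_pos _).le]
            exact mul_le_mul_of_nonneg_left (hf s hs) (Real.cosh_pos _).le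
          · rw [norm_smul, norm_mul, Complex.norm_real, Real.norm_of_nonneg hsinh]
            exact mul_le_mul (mul_le_mul_of_nonneg_right hωn hsinh) (hg s hs) (norm_nonneg _)
              (by positivity)
      _ = Real.exp ((1 - s) * r) * Y := by rw [← Real.cosh_add_sinh]; ring
      _ ≤ Real.exp r * Y := by
          refine mul_le_mul_of_nonneg_right (Real.exp_le_exp.2 ?_) hY
          nlinarith [hs.1]
  have := norm_image_sub_le_of_norm_deriv_le_segment_01' (f := F)
    (fun s _ => (hder s).hasDerivWithinAt) (fun s hs => hexp s ⟨hs.1, hs.2.le⟩)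
  simpa [hF] using this

/-! ### The Bogoliubov flow -/

theorem star_bogoliubovGenerator (BF : Finset Momentum) (Ξ : Momentum → ℂ) :
    star (bogoliubovGenerator BF Ξ) = -bogoliubovGenerator BF Ξ := by
  rw [bogoliubovGenerator, ← ContinuousLinearMap.star_eq_adjoint, star_sub, star_star, neg_sub]

theorem star_bogoliubov (BF : Finset Momentum) (Ξ : Momentum → ℂ) (t : ℝ) :
    star (bogoliubov BF Ξ t) = bogoliubov BF Ξ (-t) := by
  rw [bogoliubov, NormedSpace.star_exp, star_smul, star_bogoliubovGenerator, bogoliubov]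
  simp

theorem bogoliubov_mul_neg (BF : Finset Momentum) (Ξ : Momentum → ℂ) (t : ℝ) :
    bogoliubov BF Ξ t * bogoliubov BF Ξ (-t) = 1 := by
  let _ : NormedAlgebra ℚ (Fock →L[ℂ] Fock) := .restrictScalars ℚ ℂ _
  rw [bogoliubov, bogoliubov, Complex.ofReal_neg, neg_smul,
    ← NormedSpace.exp_add_of_commute (Commute.neg_right (Commute.refl _)), add_neg_cancel,
    NormedSpace.exp_zero]

theorem bogoliubov_zero (BF : Finset Momentum) (Ξ : Momentum → ℂ) : bogoliubov BF Ξ 0 = 1 := by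
  simp [bogoliubov]

theorem inner_bogoliubov_neg (BF : Finset Momentum) (Ξ : Momentum → ℂ) (t : ℝ) (ψ φ : Fock) :
    (inner ℂ (bogoliubov BF Ξ (-t) ψ) (bogoliubov BF Ξ (-t) φ) : ℂ) = inner ℂ ψ φ := by
  rw [← ContinuousLinearMap.adjoint_inner_right, ← ContinuousLinearMap.star_eq_adjoint,
    star_bogoliubov, neg_neg]
  change (inner ℂ ψ ((bogoliubov BF Ξ t * bogoliubov BF Ξ (-t)) φ) : ℂ) = _
  rw [bogoliubov_mul_neg]
  rfl

theorem norm_bogoliubov_neg (BF : Finset Momentum) (Ξ : Momentum → ℂ) (t : ℝ) (ψ : Fock) :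
    ‖bogoliubov BF Ξ (-t) ψ‖ = ‖ψ‖ := by
  rw [@norm_eq_sqrt_re_inner ℂ, inner_bogoliubov_neg, ← @norm_eq_sqrt_re_inner ℂ]

/-- Heisenberg's equation of motion, evaluated in the vacuum. -/
theorem hasDerivAt_heisenberg (BF : Finset Momentum) (Ξ : Momentum → ℂ) (A : Fock →L[ℂ] Fock)
    (s : ℝ) :
    HasDerivAt (fun s : ℝ => bogoliubov BF Ξ (-s) (A (trialState BF Ξ s)))
      (bogoliubov BF Ξ (-s)
        ((A * bogoliubovGenerator BF Ξ - bogoliubovGenerator BF Ξ * A) (trialState BF Ξ s))) s := by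
  set G := bogoliubovGenerator BF Ξ with hG
  have h1 : HasDerivAt (fun t : ℂ => NormedSpace.exp (t • G)) (G * NormedSpace.exp ((s : ℂ) • G))
      (s : ℂ) := hasDerivAt_exp_smul_const' G (s : ℂ)
  have h2 : HasDerivAt (fun t : ℂ => NormedSpace.exp (t • (-G)))
      (NormedSpace.exp ((s : ℂ) • (-G)) * (-G)) (s : ℂ) := hasDerivAt_exp_smul_const (-G) (s : ℂ)
  have h3 := ((h2.mul_const A).mul h1)
  have h4 := ((ContinuousLinearMap.apply ℂ Fock vacuum).hasFDerivAt.comp_hasDerivAt (s : ℂ) h3)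
  have h5 := h4.scomp s Complex.ofRealCLM.hasDerivAt
  refine (h5.congr_deriv ?_).congr_of_eventuallyEq (Filter.Eventually.of_forall fun t => ?_)
  · simp only [Complex.ofRealCLM_apply, Complex.ofReal_one, one_smul,
      ContinuousLinearMap.apply_apply, trialState, bogoliubov, ← hG, Complex.ofReal_neg,
      smul_neg, neg_smul, add_apply, sub_apply, mul_neg, neg_mul, neg_apply, map_sub,
      mul_apply_eq_comp]
    abel
  · simp only [Function.comp_apply, ContinuousLinearMap.apply_apply, trialState, bogoliubov, ← hG,
      Complex.ofReal_neg, smul_neg, neg_smul, Pi.mul_apply, mul_apply_eq_comp]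

/-! ### Normalized pair operators -/

/-- The normalized pair annihilation operator `b_k`, the adjoint of `b*_k`. -/
noncomputable def pairAnnihilation (BF : Finset Momentum) (k : Momentum) : Fock →L[ℂ] Fock :=
  star (pairCreation BF k)

theorem pairAnnihilation_eq (BF : Finset Momentum) (k : Momentum) :
    pairAnnihilation BF k = ((pairNorm BF k : ℂ)⁻¹) • pairAnnihilationTilde BF k := by
  rw [pairAnnihilation, pairCreation, star_smul]
  simp [pairAnnihilationTilde, ContinuousLinearMap.star_eq_adjoint]

theorem star_pairAnnihilation (BF : Finset Momentum) (k : Momentum) :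
    star (pairAnnihilation BF k) = pairCreation BF k := star_star _

theorem commute_pairCreation (BF : Finset Momentum) (k l : Momentum) :
    Commute (pairCreation BF k) (pairCreation BF l) :=
  ((commute_pairCreationTilde BF k l).smul_left _).smul_right _

theorem pairAnnihilation_vacuum (BF : Finset Momentum) (k : Momentum) :
    pairAnnihilation BF k vacuum = 0 := by
  rw [pairAnnihilation_eq, smul_apply, pairAnnihilationTilde_vacuum, smul_zero]

theorem one_le_pairNorm_of_ne_zero {BF : Finset Momentum} (hBF : BF.Nonempty) {k : Momentum}
    (hk : k ≠ 0) : 1 ≤ pairNorm BF k := by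
  have h := pairNorm_pos BF hBF k hk
  have h1 := pairNorm_sq BF k
  have h2 : 0 < (pairHoles BF k).card := by
    have : (0 : ℝ) < (pairHoles BF k).card := h1 ▸ pow_pos h 2
    exact_mod_cast this
  have h3 : (1 : ℝ) ≤ pairNorm BF k ^ 2 := by
    rw [h1]
    exact_mod_cast h2
  nlinarith

theorem norm_pairCreation_vacuum {BF : Finset Momentum} (hBF : BF.Nonempty) {k : Momentum}
    (hk : k ≠ 0) : ‖pairCreation BF k vacuum‖ = 1 := by
  have h := pairNorm_pos BF hBF k hk
  rw [pairCreation, smul_apply, norm_smul, norm_inv, Complex.norm_real,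
    Real.norm_of_nonneg h.le]
  exact inv_mul_cancel₀ h.ne'

theorem hasDegree_pairCreation (BF : Finset Momentum) (k : Momentum) :
    HasDegree 2 (pairCreation BF k) := (hasDegree_pairCreationTilde BF k).smul _

theorem norm_pairCreation_apply_le {BF : Finset Momentum} (hBF : BF.Nonempty) {k : Momentum}
    (hk : k ≠ 0) {n : ℕ} {ψ : Fock} (hψ : sectorProj n ψ = ψ) :
    ‖pairCreation BF k ψ‖ ≤ √(n + 1) * ‖ψ‖ := by
  have h := pairNorm_pos BF hBF k hk
  rw [pairCreation, smul_apply, norm_smul, norm_inv, Complex.norm_real,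
    Real.norm_of_nonneg h.le, inv_mul_le_iff₀ h, ← sq_le_sq₀ (norm_nonneg _) (by positivity)]
  refine (norm_sq_pairCreationTilde_le BF k hψ).trans (le_of_eq ?_)
  rw [mul_pow, mul_pow, Real.sq_sqrt (by positivity)]

/-- The deviation `[b_k, b*_l] - δ_{kl}` from the bosonic commutation relations. -/
noncomputable def pairDefect (BF : Finset Momentum) (k l : Momentum) : Fock →L[ℂ] Fock :=
  pairAnnihilation BF k * pairCreation BF l - pairCreation BF l * pairAnnihilation BF k
    - (if k = l then 1 else 0)

theorem pairDefect_eq {BF : Finset Momentum} (hBF : BF.Nonempty) {k : Momentum} (hk : k ≠ 0)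
    (l : Momentum) :
    pairDefect BF k l
      = ((pairNorm BF k : ℂ)⁻¹ * (pairNorm BF l : ℂ)⁻¹) • pairDefectTilde BF k l := by
  have h : (pairNorm BF k : ℂ) ≠ 0 := by exact_mod_cast (pairNorm_pos BF hBF k hk).ne'
  have hone : (if k = l then (1 : Fock →L[ℂ] Fock) else 0)
      = ((pairNorm BF k : ℂ)⁻¹ * (pairNorm BF l : ℂ)⁻¹) •
        (if k = l then ((pairHoles BF k).card : Fock →L[ℂ] Fock) else 0) := by
    split_ifs with hkl
    · subst hkl
      have hc : ((pairHoles BF k).card : Fock →L[ℂ] Fock)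
          = ((pairNorm BF k : ℂ) ^ 2) • (1 : Fock →L[ℂ] Fock) := by
        rw [← Complex.ofReal_pow, pairNorm_sq, Complex.ofReal_natCast, Nat.cast_smul_eq_nsmul,
          nsmul_one]
      rw [hc, smul_smul]
      have : (pairNorm BF k : ℂ)⁻¹ * (pairNorm BF k : ℂ)⁻¹ * (pairNorm BF k : ℂ) ^ 2 = 1 := by
        field_simp
      rw [this, one_smul]
    · simp
  rw [pairDefect, pairDefectTilde, hone, pairAnnihilation_eq, pairCreation]
  simp only [smul_mul_smul_comm, smul_sub]
  rw [mul_comm (pairNorm BF l : ℂ)⁻¹]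

theorem norm_pairDefect_le {BF : Finset Momentum} (hBF : BF.Nonempty) {k : Momentum} (hk : k ≠ 0)
    (l : Momentum) {n : ℕ} {ψ : Fock} (hψ : sectorProj n ψ = ψ) :
    ‖pairDefect BF k l ψ‖ ≤ (pairNorm BF l * pairNorm BF k)⁻¹ * (n * ‖ψ‖) := by
  rw [pairDefect_eq hBF hk, smul_apply, norm_smul, norm_mul, norm_inv, norm_inv,
    Complex.norm_real, Complex.norm_real, Real.norm_of_nonneg (pairNorm_nonneg _ _),
    Real.norm_of_nonneg (pairNorm_nonneg _ _), mul_inv_rev]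
  refine mul_le_mul_of_nonneg_left (norm_pairDefectTilde_le BF k l hψ) ?_
  have := pairNorm_nonneg BF k
  have := pairNorm_nonneg BF l
  positivity

theorem hasDegree_pairDefect (BF : Finset Momentum) (k l : Momentum) :
    HasDegree 0 (pairDefect BF k l) := by
  have hc := hasDegree_pairCreation BF l
  have ha : HasDegree (-2) (pairAnnihilation BF k) := (hasDegree_pairCreation BF k).star
  refine ((ha.mul hc (by norm_num)).sub (hc.mul ha (by norm_num))).sub fun n => ?_
  split_ifs <;> simp

/-! ### The commutator with the generator -/

/-- The deviation `[b_k, B] - Ξ(k) b*_{-k}` from the action of a bosonic Bogoliubov generator. -/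
noncomputable def generatorDefect (BF : Finset Momentum) (Ξ : Momentum → ℂ) (k : Momentum) :
    Fock →L[ℂ] Fock :=
  pairAnnihilation BF k * bogoliubovGenerator BF Ξ
    - bogoliubovGenerator BF Ξ * pairAnnihilation BF k - Ξ k • pairCreation BF (-k)

theorem pairAnnihilation_commutator_generator (BF : Finset Momentum) (Ξ : Momentum → ℂ)
    (k : Momentum) :
    pairAnnihilation BF k * bogoliubovGenerator BF Ξ
      - bogoliubovGenerator BF Ξ * pairAnnihilation BF k
      = Ξ k • pairCreation BF (-k) + generatorDefect BF Ξ k := by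
  rw [generatorDefect]
  abel

theorem pairCreation_commutator_generator (BF : Finset Momentum) (Ξ : Momentum → ℂ)
    (hΞ_even : ∀ k, Ξ (-k) = Ξ k) (k : Momentum) :
    pairCreation BF (-k) * bogoliubovGenerator BF Ξ
      - bogoliubovGenerator BF Ξ * pairCreation BF (-k)
      = starRingEnd ℂ (Ξ k) • pairAnnihilation BF k + star (generatorDefect BF Ξ (-k)) := by
  have h := congrArg star (pairAnnihilation_commutator_generator BF Ξ (-k))
  rw [neg_neg, hΞ_even] at h
  simp only [star_sub, star_mul, star_add, star_smul, star_bogoliubovGenerator,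
    star_pairAnnihilation] at h
  rw [pairAnnihilation, starRingEnd_apply, ← h]
  noncomm_ring

theorem commute_pairAnnihilation_star_creationPart (BF : Finset Momentum) (Ξ : Momentum → ℂ)
    (k : Momentum) :
    Commute (pairAnnihilation BF k) (star (bogoliubovCreationPart BF Ξ)) := by
  have h : Commute (pairCreation BF k) (bogoliubovCreationPart BF Ξ) := by
    rw [bogoliubovCreationPart]
    exact (Commute.tsum_right _ fun l => ((commute_pairCreation BF k _).mul_right
      (commute_pairCreation BF k _)).smul_right _).smul_right _
  exact h.star_star

theorem hasSum_generatorDefect (BF : Finset Momentum) (Ξ : Momentum → ℂ)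
    (hΞ_even : ∀ k, Ξ (-k) = Ξ k) (hΞ : Summable fun k => ‖Ξ k‖) {k : Momentum} (hk : k ≠ 0) :
    HasSum (fun l : {l : Momentum // l ≠ 0} => (1 / 2 * Ξ l) •
      (pairDefect BF k l * pairCreation BF (-(l : Momentum))
        + pairCreation BF l * pairDefect BF k (-(l : Momentum)))) (generatorDefect BF Ξ k) := by
  set β := pairAnnihilation BF k
  have hs := (summable_bogoliubov BF Ξ hΞ).hasSum.const_smul (1 / 2 : ℂ)
  have h1 := (hs.mul_left β).sub (hs.mul_right β)
  -- The bosonic part of the commutator comes from the two labels `l = ±k`.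
  have h2 : HasSum (fun l : {l : Momentum // l ≠ 0} =>
      (if l = ⟨k, hk⟩ then (1 / 2 * Ξ k) • pairCreation BF (-k) else 0)
        + (if l = ⟨-k, neg_ne_zero.2 hk⟩ then (1 / 2 * Ξ k) • pairCreation BF (-k) else 0))
      (Ξ k • pairCreation BF (-k)) := by
    have := (hasSum_ite_eq (⟨k, hk⟩ : {l : Momentum // l ≠ 0})
      ((1 / 2 * Ξ k) • pairCreation BF (-k))).add
      (hasSum_ite_eq (⟨-k, neg_ne_zero.2 hk⟩ : {l : Momentum // l ≠ 0})
      ((1 / 2 * Ξ k) • pairCreation BF (-k)))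
    rwa [← add_smul, show 1 / 2 * Ξ k + 1 / 2 * Ξ k = Ξ k by ring] at this
  have hG : generatorDefect BF Ξ k = β * bogoliubovCreationPart BF Ξ
      - bogoliubovCreationPart BF Ξ * β - Ξ k • pairCreation BF (-k) := by
    have := (commute_pairAnnihilation_star_creationPart BF Ξ k).eq
    rw [generatorDefect, bogoliubovGenerator, ← ContinuousLinearMap.star_eq_adjoint, mul_sub,
      sub_mul, this]
    abel
  rw [hG, bogoliubovCreationPart]
  refine (congrArg (fun F => HasSum F _) (funext fun l => ?_)).mpr (h1.sub h2)
  have e1 : (if l = ⟨k, hk⟩ then (1 / 2 * Ξ k) • pairCreation BF (-k) else 0)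
      = (1 / 2 * Ξ l) • ((if k = l then 1 else 0) * pairCreation BF (-(l : Momentum))) := by
    by_cases h : k = l
    · simp [h]
    · simp [h, show l ≠ ⟨k, hk⟩ from fun e => h (by rw [e])]
  have e2 : (if l = ⟨-k, neg_ne_zero.2 hk⟩ then (1 / 2 * Ξ k) • pairCreation BF (-k) else 0)
      = (1 / 2 * Ξ l) • (pairCreation BF l * (if k = -(l : Momentum) then 1 else 0)) := by
    by_cases h : k = -(l : Momentum)
    · have h' : (l : Momentum) = -k := by rw [h, neg_neg]
      simp [h, hΞ_even]
    · simp [h, show l ≠ ⟨-k, neg_ne_zero.2 hk⟩ from fun e => h (by rw [e, neg_neg])]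
  rw [e1, e2, ← smul_add, smul_smul, mul_smul_comm, smul_mul_assoc, ← smul_sub, ← smul_sub]
  congr 1
  rw [pairDefect, pairDefect]
  noncomm_ring

/-- `∑_{m ≠ 0} |Ξ(m)| / (n_m n_k)` as a real number. -/
noncomputable def realKernelSum (BF : Finset Momentum) (Ξ : Momentum → ℂ) (k : Momentum) : ℝ :=
  ∑' m : {m : Momentum // m ≠ 0}, ‖Ξ m‖ / (pairNorm BF m * pairNorm BF k)

theorem div_pairNorm_nonneg (BF : Finset Momentum) (Ξ : Momentum → ℂ) (m k : Momentum) :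
    0 ≤ ‖Ξ m‖ / (pairNorm BF m * pairNorm BF k) :=
  div_nonneg (norm_nonneg _) (mul_nonneg (pairNorm_nonneg _ _) (pairNorm_nonneg _ _))

theorem summable_realKernelSum {BF : Finset Momentum} (hBF : BF.Nonempty) {Ξ : Momentum → ℂ}
    (hΞ : Summable fun k => ‖Ξ k‖) {k : Momentum} (hk : k ≠ 0) :
    Summable fun m : {m : Momentum // m ≠ 0} => ‖Ξ m‖ / (pairNorm BF m * pairNorm BF k) := by
  refine Summable.of_nonneg_of_le (fun m => div_pairNorm_nonneg BF Ξ m k) (fun m => ?_)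
    (hΞ.comp_injective Subtype.val_injective)
  exact div_le_self (norm_nonneg _) (one_le_mul_of_one_le_of_one_le
    (one_le_pairNorm_of_ne_zero hBF m.2) (one_le_pairNorm_of_ne_zero hBF hk))

theorem realKernelSum_nonneg (BF : Finset Momentum) (Ξ : Momentum → ℂ) (k : Momentum) :
    0 ≤ realKernelSum BF Ξ k := tsum_nonneg fun m => div_pairNorm_nonneg BF Ξ m k

theorem kernelSum_eq {BF : Finset Momentum} (hBF : BF.Nonempty) {Ξ : Momentum → ℂ}
    (hΞ : Summable fun k => ‖Ξ k‖) {k : Momentum} (hk : k ≠ 0) :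
    kernelSum BF Ξ k = ENNReal.ofReal (realKernelSum BF Ξ k) :=
  (ENNReal.ofReal_tsum_of_nonneg (fun m : {m : Momentum // m ≠ 0} => div_pairNorm_nonneg BF Ξ m k)
    (summable_realKernelSum hBF hΞ hk)).symm

theorem realKernelSum_neg (BF : Finset Momentum) (Ξ : Momentum → ℂ) (k : Momentum) :
    realKernelSum BF Ξ (-k) = realKernelSum BF Ξ k := by
  simp only [realKernelSum, pairNorm_neg]

theorem hasDegree_generatorDefect (BF : Finset Momentum) {Ξ : Momentum → ℂ}
    (hΞ_even : ∀ k, Ξ (-k) = Ξ k) (hΞ : Summable fun k => ‖Ξ k‖) {k : Momentum} (hk : k ≠ 0) :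
    HasDegree 2 (generatorDefect BF Ξ k) := by
  refine HasDegree.of_hasSum (fun l => ?_) (hasSum_generatorDefect BF Ξ hΞ_even hΞ hk)
  exact (((hasDegree_pairDefect BF k _).mul (hasDegree_pairCreation BF _) (by norm_num)).add
    ((hasDegree_pairCreation BF _).mul (hasDegree_pairDefect BF k _) (by norm_num))).smul _

theorem norm_generatorDefect_le {BF : Finset Momentum} (hBF : BF.Nonempty) {Ξ : Momentum → ℂ}
    (hΞ_even : ∀ k, Ξ (-k) = Ξ k) (hΞ : Summable fun k => ‖Ξ k‖) {k : Momentum} (hk : k ≠ 0)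
    {n : ℕ} {ψ : Fock} (hψ : sectorProj n ψ = ψ) :
    ‖generatorDefect BF Ξ k ψ‖ ≤ realKernelSum BF Ξ k * ((n : ℝ) + 2) ^ (3 / 2 : ℝ) * ‖ψ‖ := by
  have hsum := (hasSum_generatorDefect BF Ξ hΞ_even hΞ hk).mapL
    (ContinuousLinearMap.apply ℂ Fock ψ)
  have hc := ((summable_realKernelSum hBF hΞ hk).mul_right
    (((n : ℝ) + 2) ^ (3 / 2 : ℝ) * ‖ψ‖)).hasSum
  rw [tsum_mul_right, ← mul_assoc] at hc
  -- The two orderings contribute `½ ((n+2) √(n+1) + √(n+1) n) = √(n+1) (n+1)`.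
  have hpow : √((n : ℝ) + 1) * (n + 1) ≤ ((n : ℝ) + 2) ^ (3 / 2 : ℝ) := by
    have h0 : (0 : ℝ) < (n : ℝ) + 2 := by positivity
    rw [show (3 / 2 : ℝ) = 1 / 2 + 1 by norm_num, Real.rpow_add h0, Real.rpow_one,
      ← Real.sqrt_eq_rpow]
    gcongr <;> linarith
  refine (hsum.tsum_eq ▸ tsum_of_norm_bounded hc fun l => ?_)
  have hl' := neg_ne_zero.2 l.2
  set D := (pairNorm BF l * pairNorm BF k)⁻¹ with hD
  have hD0 : 0 ≤ D := inv_nonneg.2 (mul_nonneg (pairNorm_nonneg _ _) (pairNorm_nonneg _ _))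
  have t1 : ‖pairDefect BF k l (pairCreation BF (-(l : Momentum)) ψ)‖
      ≤ D * ((n + 2) * (√(n + 1) * ‖ψ‖)) := by
    refine (norm_pairDefect_le hBF hk l (n := n + 2)
      ((hasDegree_pairCreation BF _).apply_of_eq hψ (by push_cast; rfl))).trans ?_
    push_cast
    gcongr
    exact norm_pairCreation_apply_le hBF hl' hψ
  have t2 : ‖pairCreation BF l (pairDefect BF k (-(l : Momentum)) ψ)‖
      ≤ √(n + 1) * (D * (n * ‖ψ‖)) := by
    refine (norm_pairCreation_apply_le hBF l.2 (n := n)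
      ((hasDegree_pairDefect BF k _).apply_of_eq hψ (by simp))).trans ?_
    gcongr
    refine (norm_pairDefect_le hBF hk _ hψ).trans (le_of_eq ?_)
    rw [pairNorm_neg]
  change ‖(1 / 2 * Ξ l) • (pairDefect BF k l (pairCreation BF (-(l : Momentum)) ψ)
    + pairCreation BF l (pairDefect BF k (-(l : Momentum)) ψ))‖ ≤ _
  rw [norm_smul, norm_mul]
  calc ‖(1 / 2 : ℂ)‖ * ‖Ξ l‖ * _
      ≤ 1 / 2 * ‖Ξ l‖ * (D * ((n + 2) * (√(n + 1) * ‖ψ‖)) + √(n + 1) * (D * (n * ‖ψ‖))) := by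
        rw [show ‖(1 / 2 : ℂ)‖ = 1 / 2 by norm_num]
        gcongr
        exact (norm_add_le _ _).trans (add_le_add t1 t2)
    _ = ‖Ξ l‖ * D * ((√(n + 1) * (n + 1)) * ‖ψ‖) := by ring
    _ ≤ ‖Ξ l‖ * D * (((n : ℝ) + 2) ^ (3 / 2 : ℝ) * ‖ψ‖) := by gcongr
    _ = _ := by rw [hD, ← div_eq_mul_inv]

/-- A bound on an operator that adds two particles passes to its adjoint. -/
theorem norm_star_generatorDefect_le {BF : Finset Momentum} (hBF : BF.Nonempty) {Ξ : Momentum → ℂ}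
    (hΞ_even : ∀ k, Ξ (-k) = Ξ k) (hΞ : Summable fun k => ‖Ξ k‖) {k : Momentum} (hk : k ≠ 0)
    {n : ℕ} {ψ : Fock} (hψ : sectorProj n ψ = ψ) :
    ‖star (generatorDefect BF Ξ k) ψ‖
      ≤ realKernelSum BF Ξ k * ((n : ℝ) + 2) ^ (3 / 2 : ℝ) * ‖ψ‖ := by
  set φ := star (generatorDefect BF Ξ k) ψ with hφ
  have hκ := realKernelSum_nonneg BF Ξ k
  have hφn : sectorProj ((n : ℤ) - 2) φ = φ :=
    (hasDegree_generatorDefect BF hΞ_even hΞ hk).star.apply_of_eq hψ rfl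
  by_cases h0 : φ = 0
  · rw [h0, norm_zero]
    positivity
  have hn : 2 ≤ n := by
    by_contra hn
    rw [sectorProj_of_neg (by omega)] at hφn
    exact h0 hφn.symm
  obtain ⟨m, rfl⟩ := Nat.exists_eq_add_of_le' hn
  have hφm : sectorProj (m : ℤ) φ = φ := by
    convert hφn using 2
    push_cast
    ring_nf
  have h1 : ‖φ‖ ^ 2 ≤ ‖ψ‖ * ‖generatorDefect BF Ξ k φ‖ := by
    have : (inner ℂ φ φ : ℂ) = inner ℂ ψ (generatorDefect BF Ξ k φ) := by
      conv_lhs => rw [hφ, ContinuousLinearMap.star_eq_adjoint,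
        ContinuousLinearMap.adjoint_inner_left]
      rfl
    have h2 : ‖φ‖ ^ 2 = ‖(inner ℂ φ φ : ℂ)‖ := by
      rw [inner_self_eq_norm_sq_to_K]; simp
    rw [h2, this]
    exact norm_inner_le_norm _ _
  have h2 := norm_generatorDefect_le hBF hΞ_even hΞ hk hφm
  have h3 : ((m : ℝ) + 2) ^ (3 / 2 : ℝ) ≤ (((m + 2 : ℕ) : ℝ) + 2) ^ (3 / 2 : ℝ) := by
    refine Real.rpow_le_rpow (by positivity) ?_ (by norm_num)
    push_cast
    linarith
  refine le_of_mul_le_mul_right ?_ (norm_pos_iff.2 h0)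
  calc ‖φ‖ * ‖φ‖ = ‖φ‖ ^ 2 := by ring
    _ ≤ ‖ψ‖ * (realKernelSum BF Ξ k * ((m : ℝ) + 2) ^ (3 / 2 : ℝ) * ‖φ‖) :=
        h1.trans (mul_le_mul_of_nonneg_left h2 (norm_nonneg _))
    _ ≤ ‖ψ‖ * (realKernelSum BF Ξ k * (((m + 2 : ℕ) : ℝ) + 2) ^ (3 / 2 : ℝ) * ‖φ‖) := by gcongr
    _ = _ := by ring

theorem enorm_generatorDefect_trialState_le {BF : Finset Momentum} (hBF : BF.Nonempty)
    {Ξ : Momentum → ℂ} (hΞ_even : ∀ k, Ξ (-k) = Ξ k) (hΞ : Summable fun k => ‖Ξ k‖)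
    {k : Momentum} (hk : k ≠ 0) {s : ℝ} (hs : s ∈ Set.Icc (0 : ℝ) 1) :
    ‖generatorDefect BF Ξ k (trialState BF Ξ s)‖ₑ ≤ kernelSum BF Ξ k * supNumberNorm BF Ξ ∧
    ‖star (generatorDefect BF Ξ k) (trialState BF Ξ s)‖ₑ
      ≤ kernelSum BF Ξ k * supNumberNorm BF Ξ := by
  have hdeg := hasDegree_generatorDefect BF hΞ_even hΞ hk
  have hsup : numberNorm (fun j => ((j : ℝ) + 2) ^ (3 / 2 : ℝ)) (trialState BF Ξ s)
      ≤ supNumberNorm BF Ξ := le_iSup₂ (f := fun t (_ : t ∈ Set.Icc (0 : ℝ) 1) =>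
        numberNorm (fun j => ((j : ℝ) + 2) ^ (3 / 2 : ℝ)) (trialState BF Ξ t)) s hs
  rw [kernelSum_eq hBF hΞ hk]
  have hκ := realKernelSum_nonneg BF Ξ k
  exact ⟨(hdeg.enorm_apply_le hκ (fun n => by positivity)
      (fun n φ hφ => norm_generatorDefect_le hBF hΞ_even hΞ hk hφ) _).trans (by gcongr),
    (hdeg.star.enorm_apply_le hκ (fun n => by positivity)
      (fun n φ hφ => norm_star_generatorDefect_le hBF hΞ_even hΞ hk hφ) _).trans (by gcongr)⟩

/-! ### The interaction energy of one momentum -/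

/-- `½ ⟨TΩ, V̂(k) (2 b̃*_k b̃_k + b̃*_k b̃*_{-k} + b̃_{-k} b̃_k) TΩ⟩`, which is real. -/
noncomputable def termEnergy (BF : Finset Momentum) (V : Momentum → ℝ) (Ξ : Momentum → ℂ)
    (k : Momentum) : ℝ :=
  V k * pairNorm BF k ^ 2 * (‖pairAnnihilation BF k (trialState BF Ξ 1)‖ ^ 2
    + (inner ℂ (pairCreation BF (-k) (trialState BF Ξ 1))
        (pairAnnihilation BF k (trialState BF Ξ 1)) : ℂ).re)

theorem inner_interactionTerm {BF : Finset Momentum} (hBF : BF.Nonempty) (V : Momentum → ℝ)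
    (Ξ : Momentum → ℂ) {k : Momentum} (hk : k ≠ 0) :
    (inner ℂ (trialState BF Ξ 1) (interactionTerm BF V k (trialState BF Ξ 1)) : ℂ)
      = ((2 * termEnergy BF V Ξ k : ℝ) : ℂ) := by
  set ψ := trialState BF Ξ 1
  have hn : ∀ {l : Momentum}, l ≠ 0 → (pairNorm BF l : ℂ) ≠ 0 := fun hl => by
    exact_mod_cast (pairNorm_pos BF hBF _ hl).ne'
  have hc : ∀ {l : Momentum}, l ≠ 0 →
      pairCreationTilde BF l = (pairNorm BF l : ℂ) • pairCreation BF l := fun hl => by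
    rw [pairCreation, smul_smul, mul_inv_cancel₀ (hn hl), one_smul]
  have ha : ∀ {l : Momentum}, l ≠ 0 →
      pairAnnihilationTilde BF l = (pairNorm BF l : ℂ) • pairAnnihilation BF l := fun hl => by
    rw [pairAnnihilation_eq, smul_smul, mul_inv_cancel₀ (hn hl), one_smul]
  have hk' := neg_ne_zero.2 hk
  have hcr : ∀ (l : Momentum) (φ χ : Fock), (inner ℂ φ (pairCreation BF l χ) : ℂ)
      = inner ℂ (pairAnnihilation BF l φ) χ := fun l φ χ => by
    rw [pairAnnihilation, ContinuousLinearMap.star_eq_adjoint,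
      ContinuousLinearMap.adjoint_inner_left]
  have han : ∀ (l : Momentum) (φ χ : Fock), (inner ℂ φ (pairAnnihilation BF l χ) : ℂ)
      = inner ℂ (pairCreation BF l φ) χ := fun l φ χ => by
    rw [pairAnnihilation, ContinuousLinearMap.star_eq_adjoint,
      ContinuousLinearMap.adjoint_inner_right]
  have hconj : (inner ℂ (pairAnnihilation BF k ψ) (pairCreation BF (-k) ψ) : ℂ)
      + inner ℂ (pairCreation BF (-k) ψ) (pairAnnihilation BF k ψ)
      = ((2 * (inner ℂ (pairCreation BF (-k) ψ) (pairAnnihilation BF k ψ) : ℂ).re : ℝ) : ℂ) := by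
    rw [← inner_conj_symm, add_comm, Complex.add_conj]
  rw [interactionTerm, hc hk, hc hk', ha hk, ha hk', pairNorm_neg]
  simp only [smul_mul_smul_comm, smul_apply, add_apply, inner_smul_right, inner_add_right,
    mul_apply_eq_comp, hcr k, han (-k), inner_self_eq_norm_sq_to_K]
  rw [add_assoc, ← mul_add, hconj, termEnergy]
  simp only [Complex.coe_algebraMap]
  push_cast
  ring

/-- Expansion of `‖X‖² + Re ⟨Z, X⟩` for `X` close to `ω sinh(r) v` and `Z` close to `cosh(r) v`. -/
theorem abs_norm_sq_add_re_inner_sub_le {E : Type*} [NormedAddCommGroup E]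
    [InnerProductSpace ℂ E] {v x y : E} (hv : ‖v‖ = 1) {ω : ℂ} {s c δ : ℝ}
    (hωs : ‖ω‖ * s = s) (hs : 0 ≤ s) (hc : 0 ≤ c) (hx : ‖x‖ ≤ δ) (hy : ‖y‖ ≤ δ) :
    |‖(ω * s) • v + x‖ ^ 2 + (inner ℂ ((c : ℂ) • v + y) ((ω * s) • v + x) : ℂ).re
      - (s ^ 2 + ω.re * (s * c))| ≤ (4 * s + 2 * c) * δ + 4 * δ ^ 2 := by
  have hδ : 0 ≤ δ := (norm_nonneg _).trans hx
  have hvv : (inner ℂ v v : ℂ) = 1 := by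
    rw [inner_self_eq_norm_sq_to_K, hv]; norm_num
  have hαn : ‖ω * s‖ = s := by
    rw [norm_mul, Complex.norm_real, Real.norm_of_nonneg hs, hωs]
  set α : ℂ := ω * s with hα
  have e1 : ‖α • v + x‖ ^ 2 = s ^ 2 + 2 * (inner ℂ (α • v) x : ℂ).re + ‖x‖ ^ 2 := by
    rw [@norm_add_sq ℂ, norm_smul, hv, hαn, mul_one]
    rfl
  have e2 : (inner ℂ ((c : ℂ) • v + y) (α • v + x) : ℂ).re
      = ω.re * (s * c) + (inner ℂ ((c : ℂ) • v) x : ℂ).re + (inner ℂ y (α • v) : ℂ).re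
        + (inner ℂ y x : ℂ).re := by
    rw [inner_add_left, inner_add_right, inner_add_right, inner_smul_left (x := v) (y := α • v),
      inner_smul_right (x := v) (y := v), hvv, Complex.conj_ofReal, hα]
    simp only [Complex.add_re, mul_one, Complex.re_ofReal_mul, Complex.re_mul_ofReal]
    ring
  have b : ∀ a a' : E, |(inner ℂ a a' : ℂ).re| ≤ ‖a‖ * ‖a'‖ := fun a a' =>
    (Complex.abs_re_le_norm _).trans (norm_inner_le_norm _ _)
  have b1 : |(inner ℂ (α • v) x : ℂ).re| ≤ s * δ := (b _ _).trans <| by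
    rw [norm_smul, hv, hαn, mul_one]; gcongr
  have b2 : |(inner ℂ ((c : ℂ) • v) x : ℂ).re| ≤ c * δ := (b _ _).trans <| by
    rw [norm_smul, hv, Complex.norm_real, Real.norm_of_nonneg hc, mul_one]; gcongr
  have b3 : |(inner ℂ y (α • v) : ℂ).re| ≤ δ * s := (b _ _).trans <| by
    rw [norm_smul, hv, hαn, mul_one]; gcongr
  have b4 : |(inner ℂ y x : ℂ).re| ≤ δ * δ := (b _ _).trans <| by gcongr
  have b5 : ‖x‖ ^ 2 ≤ δ ^ 2 := pow_le_pow_left₀ (norm_nonneg _) hx 2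
  have b6 : 0 ≤ ‖x‖ ^ 2 := sq_nonneg _
  rw [e1, e2]
  rw [abs_le] at *
  have := mul_nonneg hs hδ
  have := mul_nonneg hc hδ
  constructor <;> nlinarith

theorem leadingTerm_re (BF : Finset Momentum) (V : Momentum → ℝ) (Ξ : Momentum → ℂ)
    (k : Momentum) :
    (leadingTerm BF V Ξ k).re = V k * pairNorm BF k ^ 2 * (Real.sinh ‖Ξ k‖ ^ 2
      + (Ξ k / (‖Ξ k‖ : ℂ)).re * (Real.sinh ‖Ξ k‖ * Real.cosh ‖Ξ k‖)) := by
  have : (starRingEnd ℂ (Ξ k) / (‖Ξ k‖ : ℂ)) = starRingEnd ℂ (Ξ k / (‖Ξ k‖ : ℂ)) := by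
    rw [map_div₀, Complex.conj_ofReal]
  rw [leadingTerm, this, Complex.re_ofReal_mul, Complex.add_re, Complex.ofReal_re,
    Complex.re_mul_ofReal, Complex.conj_re]

theorem abs_termEnergy_sub_le {BF : Finset Momentum} (hBF : BF.Nonempty) (V : Momentum → ℝ)
    {Ξ : Momentum → ℂ} (hΞ_even : ∀ k, Ξ (-k) = Ξ k) {k : Momentum} (hk : k ≠ 0) {Y : ℝ}
    (hY : ∀ s ∈ Set.Icc (0 : ℝ) 1, ‖generatorDefect BF Ξ k (trialState BF Ξ s)‖ ≤ Y)
    (hY' : ∀ s ∈ Set.Icc (0 : ℝ) 1, ‖star (generatorDefect BF Ξ (-k)) (trialState BF Ξ s)‖ ≤ Y) :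
    |termEnergy BF V Ξ k - (leadingTerm BF V Ξ k).re| ≤ |V k| * pairNorm BF k ^ 2 *
      ((4 * Real.sinh ‖Ξ k‖ + 2 * Real.cosh ‖Ξ k‖) * (Real.exp ‖Ξ k‖ * Y)
        + 4 * (Real.exp ‖Ξ k‖ * Y) ^ 2) := by
  set T := fun s : ℝ => bogoliubov BF Ξ (-s) with hT
  set u : ℝ → Fock := fun s => T s (pairAnnihilation BF k (trialState BF Ξ s)) with hu
  set w : ℝ → Fock := fun s => T s (pairCreation BF (-k) (trialState BF Ξ s)) with hw
  set f : ℝ → Fock := fun s => T s (generatorDefect BF Ξ k (trialState BF Ξ s)) with hf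
  set g : ℝ → Fock := fun s => T s (star (generatorDefect BF Ξ (-k)) (trialState BF Ξ s)) with hg
  have hu' : ∀ s, HasDerivAt u (Ξ k • w s + f s) s := fun s => by
    refine (hasDerivAt_heisenberg BF Ξ (pairAnnihilation BF k) s).congr_deriv ?_
    rw [pairAnnihilation_commutator_generator, add_apply, smul_apply, map_add, map_smul]
  have hw' : ∀ s, HasDerivAt w (starRingEnd ℂ (Ξ k) • u s + g s) s := fun s => by
    refine (hasDerivAt_heisenberg BF Ξ (pairCreation BF (-k)) s).congr_deriv ?_
    rw [pairCreation_commutator_generator BF Ξ hΞ_even, add_apply, smul_apply, map_add, map_smul]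
  have hfY : ∀ s ∈ Set.Icc (0 : ℝ) 1, ‖f s‖ ≤ Y := fun s hs => by
    simpa only [hf, hT, norm_bogoliubov_neg] using hY s hs
  have hgY : ∀ s ∈ Set.Icc (0 : ℝ) 1, ‖g s‖ ≤ Y := fun s hs => by
    simpa only [hg, hT, norm_bogoliubov_neg] using hY' s hs
  have h0 : trialState BF Ξ 0 = vacuum := by
    rw [trialState, bogoliubov_zero]
    rfl
  have hu0 : u 0 = 0 := by
    simp only [hu, h0, pairAnnihilation_vacuum, map_zero]
  set v := pairCreation BF (-k) vacuum with hv
  have hw0 : w 0 = v := by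
    simp only [hw, hT, h0, neg_zero, bogoliubov_zero]
    rfl
  have r1 := norm_sub_hyperbolic_rotation_le (Ξ k) u w f g Y hu' hw' hfY hgY
  have r2 := norm_sub_hyperbolic_rotation_le (starRingEnd ℂ (Ξ k)) w u g f Y hw'
    (fun s => by rw [Complex.conj_conj]; exact hu' s) hgY hfY
  rw [RCLike.norm_conj] at r2
  rw [hu0, hw0, smul_zero] at r1 r2
  rw [zero_add] at r1
  rw [add_zero] at r2
  set ω : ℂ := Ξ k / (‖Ξ k‖ : ℂ) with hω
  -- For `Ξ k = 0` the quotient `ω` is `0`, but then `sinh ‖Ξ k‖` vanishes too.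
  have hωs : ‖ω‖ * Real.sinh ‖Ξ k‖ = Real.sinh ‖Ξ k‖ := by
    by_cases hz : Ξ k = 0
    · simp [hz]
    · rw [hω, norm_div, Complex.norm_real, norm_norm, div_self (norm_ne_zero_iff.2 hz), one_mul]
  have key := abs_norm_sq_add_re_inner_sub_le (norm_pairCreation_vacuum hBF (neg_ne_zero.2 hk))
    hωs (Real.sinh_nonneg_iff.2 (norm_nonneg (Ξ k))) (Real.cosh_pos ‖Ξ k‖).le r1 r2
  rw [← hv, add_sub_cancel, add_sub_cancel] at key
  have hu1 : ‖u 1‖ = ‖pairAnnihilation BF k (trialState BF Ξ 1)‖ := norm_bogoliubov_neg _ _ _ _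
  have hi : (inner ℂ (w 1) (u 1) : ℂ) = inner ℂ (pairCreation BF (-k) (trialState BF Ξ 1))
      (pairAnnihilation BF k (trialState BF Ξ 1)) := inner_bogoliubov_neg _ _ _ _ _
  rw [hu1, hi] at key
  rw [termEnergy, leadingTerm_re, ← mul_sub, abs_mul, abs_mul,
    abs_of_nonneg (sq_nonneg (pairNorm BF k))]
  exact mul_le_mul_of_nonneg_left key (by positivity)

theorem enorm_termEnergy_sub_le {BF : Finset Momentum} (hBF : BF.Nonempty) (V : Momentum → ℝ)
    {Ξ : Momentum → ℂ} (hΞ_even : ∀ k, Ξ (-k) = Ξ k) (hΞ : Summable fun k => ‖Ξ k‖)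
    {k : Momentum} (hk : k ≠ 0) :
    ‖termEnergy BF V Ξ k - (leadingTerm BF V Ξ k).re‖ₑ ≤
      ENNReal.ofReal (|V k| * pairNorm BF k ^ 2) *
        (4 * supNumberExpect BF Ξ * ENNReal.ofReal (Real.exp (2 * ‖Ξ k‖)) * kernelSum BF Ξ k ^ 2
          + ENNReal.ofReal (4 * Real.sinh ‖Ξ k‖ + 2 * Real.cosh ‖Ξ k‖) * supNumberNorm BF Ξ
            * ENNReal.ofReal (Real.exp ‖Ξ k‖) * kernelSum BF Ξ k) := by
  have hk' := neg_ne_zero.2 hk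
  have hsinh : 0 ≤ Real.sinh ‖Ξ k‖ := Real.sinh_nonneg_iff.2 (norm_nonneg _)
  have hcosh := Real.cosh_pos ‖Ξ k‖
  have hpos : 0 < 4 * Real.sinh ‖Ξ k‖ + 2 * Real.cosh ‖Ξ k‖ := by positivity
  have hK : kernelSum BF Ξ (-k) = kernelSum BF Ξ k := by
    rw [kernelSum_eq hBF hΞ hk, kernelSum_eq hBF hΞ hk', realKernelSum_neg]
  set K := kernelSum BF Ξ k with hKdef
  set M := supNumberNorm BF Ξ
  set S := supNumberExpect BF Ξ
  set c := 4 * Real.sinh ‖Ξ k‖ + 2 * Real.cosh ‖Ξ k‖ with hc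
  set e := Real.exp ‖Ξ k‖ with he
  have he2 : Real.exp (2 * ‖Ξ k‖) = e ^ 2 := by
    rw [he, ← Real.exp_nat_mul]; norm_num
  have hMS : M ^ 2 ≤ S := supNumberNorm_sq_le BF Ξ
  have he0 : 0 < e := Real.exp_pos _
  by_cases htop : K * M = ⊤
  · -- An infinite bound is useful only if the prefactor does not vanish.
    by_cases hV : |V k| * pairNorm BF k ^ 2 = 0
    · have hV' : V k = 0 := by
        simpa [(pairNorm_pos BF hBF k hk).ne'] using hV
      simp [termEnergy, leadingTerm, hV']
    · have h1 : ENNReal.ofReal c * M * ENNReal.ofReal e * K = ⊤ := by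
        rw [show ENNReal.ofReal c * M * ENNReal.ofReal e * K
          = ENNReal.ofReal c * ENNReal.ofReal e * (K * M) by ring, htop]
        exact ENNReal.mul_top (mul_ne_zero (by simpa using hpos) (by simpa using he0))
      rw [h1, add_top, ENNReal.mul_top]
      · exact le_top
      · rw [ne_eq, ENNReal.ofReal_eq_zero, not_le]
        exact lt_of_le_of_ne (by positivity) (Ne.symm hV)
  set Y := (K * M).toReal with hYdef
  have hYK : ENNReal.ofReal Y = K * M := ENNReal.ofReal_toReal htop
  have hY0 : 0 ≤ Y := ENNReal.toReal_nonneg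
  have hle : ∀ φ : Fock, ‖φ‖ₑ ≤ K * M → ‖φ‖ ≤ Y := fun φ h => by
    rw [← ofReal_norm, ← hYK] at h
    exact (ENNReal.ofReal_le_ofReal_iff hY0).1 h
  have h := abs_termEnergy_sub_le hBF V hΞ_even hk (Y := Y)
    (fun s hs => hle _ (enorm_generatorDefect_trialState_le hBF hΞ_even hΞ hk hs).1)
    (fun s hs => hle _ (hK ▸ (enorm_generatorDefect_trialState_le hBF hΞ_even hΞ hk' hs).2))
  rw [← ofReal_norm, Real.norm_eq_abs]
  refine (ENNReal.ofReal_le_ofReal h).trans ?_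
  rw [ENNReal.ofReal_mul (by positivity)]
  gcongr
  rw [add_comm, ENNReal.ofReal_add (by positivity) (by positivity),
    ENNReal.ofReal_mul (by positivity), ENNReal.ofReal_mul hpos.le,
    ENNReal.ofReal_pow (by positivity), ENNReal.ofReal_mul he0.le, hYK, he2,
    ENNReal.ofReal_pow he0.le, ENNReal.ofReal_ofNat]
  refine add_le_add ?_ (le_of_eq (by ring))
  calc 4 * (ENNReal.ofReal e * (K * M)) ^ 2
      = 4 * M ^ 2 * ENNReal.ofReal e ^ 2 * K ^ 2 := by ring
    _ ≤ 4 * S * ENNReal.ofReal e ^ 2 * K ^ 2 := by gcongr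

/-! ### Summation over the momenta -/

theorem pairNorm_le_card (BF : Finset Momentum) (k : Momentum) : pairNorm BF k ≤ BF.card := by
  simpa [norm_vacuum, pairNorm] using
    (pairCreationTilde BF k).le_of_opNorm_le (norm_pairCreationTilde_le BF k) vacuum

theorem summable_leadingTerm (BF : Finset Momentum) {V : Momentum → ℝ}
    (hV : Summable fun k => |V k|) {Ξ : Momentum → ℂ} (hΞ : Summable fun k => ‖Ξ k‖) :
    Summable fun k : {k : Momentum // k ≠ 0} => leadingTerm BF V Ξ k := by
  set R := ∑' k, ‖Ξ k‖
  have hR : ∀ k, ‖Ξ k‖ ≤ R := fun k => hΞ.le_tsum k fun _ _ => norm_nonneg _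
  refine Summable.of_norm_bounded (g := fun k : {k : Momentum // k ≠ 0} =>
    |V k| * ((BF.card : ℝ) ^ 2 * (Real.sinh R ^ 2 + 1 * (Real.sinh R * Real.cosh R)))) ?_
    fun k => ?_
  · exact (hV.comp_injective Subtype.val_injective).mul_right _
  · have hs : 0 ≤ Real.sinh ‖Ξ k‖ := Real.sinh_nonneg_iff.2 (norm_nonneg _)
    have hs' : Real.sinh ‖Ξ k‖ ≤ Real.sinh R := Real.sinh_le_sinh.2 (hR k)
    have hc : 0 < Real.cosh ‖Ξ k‖ := Real.cosh_pos _
    have hc' : Real.cosh ‖Ξ k‖ ≤ Real.cosh R :=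
      Real.cosh_le_cosh.2 (by
        rw [abs_norm, abs_of_nonneg ((norm_nonneg _).trans (hR k))]; exact hR k)
    have hn := pairNorm_nonneg BF k
    have hn' := pairNorm_le_card BF k
    have hω : ‖starRingEnd ℂ (Ξ k) / (‖Ξ k‖ : ℂ)‖ ≤ 1 := by
      rw [norm_div, RCLike.norm_conj, Complex.norm_real, norm_norm]
      exact div_self_le_one _
    rw [leadingTerm, norm_mul, Complex.norm_real, norm_mul, Real.norm_eq_abs, norm_pow,
      Real.norm_of_nonneg hn, mul_assoc]
    gcongr
    refine (norm_add_le _ _).trans ?_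
    rw [Complex.norm_real, norm_mul, Complex.norm_real, Real.norm_of_nonneg (by positivity),
      Real.norm_of_nonneg (by positivity)]
    gcongr

theorem hasSum_termEnergy {BF : Finset Momentum} (hBF : BF.Nonempty) {V : Momentum → ℝ}
    (hV : Summable fun k => |V k|) (Ξ : Momentum → ℂ) :
    HasSum (fun k : {k : Momentum // k ≠ 0} => ((1 / (BF.card : ℝ) * termEnergy BF V Ξ k : ℝ) : ℂ))
      (inner ℂ (trialState BF Ξ 1) (interaction BF V (trialState BF Ξ 1))) := by
  set ψ := trialState BF Ξ 1
  have h1 := ((summable_interaction BF V hV).hasSum.const_smul (1 / (2 * (BF.card : ℂ)))).mapL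
    ((innerSL ℂ ψ).comp (ContinuousLinearMap.apply ℂ Fock ψ))
  refine (congrArg (fun F => HasSum F _) (funext fun k => ?_)).mpr h1
  change _ = (inner ℂ ψ (((1 / (2 * (BF.card : ℂ))) • interactionTerm BF V k) ψ) : ℂ)
  rw [smul_apply, inner_smul_right, inner_interactionTerm hBF V Ξ k.2]
  push_cast
  field_simp

end FermiGas

theorem mainTheorem5
    (N : ℕ) (hN : 0 < N)
    (BF : Finset FermiGas.Momentum) (hBF : FermiGas.IsFermiBall BF) (hcard : BF.card = N)
    (V : FermiGas.Momentum → ℝ) (hV : Summable fun k => |V k|)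
    (Ξ : FermiGas.Momentum → ℂ) (hΞ_even : ∀ k, Ξ (-k) = Ξ k)
    (hΞ : Summable fun k => ‖Ξ k‖) :
    (Summable fun k : {k : FermiGas.Momentum // k ≠ 0} => FermiGas.leadingTerm BF V Ξ k) ∧
    ∃ ε₁ : ℂ,
      inner ℂ (FermiGas.trialState BF Ξ 1)
          (FermiGas.interaction BF V (FermiGas.trialState BF Ξ 1))
        = ((1 / (N : ℝ) * (∑' k : {k : FermiGas.Momentum // k ≠ 0},
            FermiGas.leadingTerm BF V Ξ k).re : ℝ) : ℂ) + ε₁ ∧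
      ENNReal.ofReal ‖ε₁‖ ≤
        ENNReal.ofReal (1 / (N : ℝ)) * ∑' k : {k : FermiGas.Momentum // k ≠ 0},
          ENNReal.ofReal (|V k| * FermiGas.pairNorm BF k ^ 2) *
            (4 * FermiGas.supNumberExpect BF Ξ * ENNReal.ofReal (Real.exp (2 * ‖Ξ k‖))
                * FermiGas.kernelSum BF Ξ k ^ 2
              + ENNReal.ofReal (4 * Real.sinh ‖Ξ k‖ + 2 * Real.cosh ‖Ξ k‖)
                * FermiGas.supNumberNorm BF Ξ * ENNReal.ofReal (Real.exp ‖Ξ k‖)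
                * FermiGas.kernelSum BF Ξ k) := by
  have hne : BF.Nonempty := Finset.card_pos.1 (hcard ▸ hN)
  have hlead := FermiGas.summable_leadingTerm BF hV hΞ
  refine ⟨hlead, _, (add_sub_cancel _ _).symm, ?_⟩
  have h1 := FermiGas.hasSum_termEnergy hne hV Ξ
  have h2 := Complex.hasSum_ofReal.2 ((Complex.hasSum_re hlead.hasSum).mul_left (1 / (N : ℝ)))
  rw [hcard] at h1
  rw [← (h1.sub h2).tsum_eq, ofReal_norm, ← ENNReal.tsum_mul_left]
  refine enorm_tsum_le_tsum_enorm.trans (ENNReal.tsum_le_tsum fun k => ?_)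
  rw [← Complex.ofReal_sub, ← mul_sub, Complex.ofReal_mul, enorm_mul]
  have e : ∀ x : ℝ, ‖(x : ℂ)‖ₑ = ‖x‖ₑ := fun x => by
    rw [← ofReal_norm, ← ofReal_norm, Complex.norm_real]
  rw [e, e, Real.enorm_of_nonneg (by positivity)]
  exact mul_le_mul_right (FermiGas.enorm_termEnergy_sub_le hne V hΞ_even hΞ k.2) _
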